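/- **Setting.** For a binary number $x=(x_0,\dots,x_{n-1})\in\{0,1\}^n$ let $|x|=\sum_i x_i2^i$. Let $[a_i,b_i]$, $a_i<b_i$, $0\le i\le N-1$, be closed real intervals, labelled so that $a_0\le a_1\le\dots\le a_{N-1}$, and let $G=(V,E)$ be their interval graph: its nodes are $v_0,\dots,v_{N-1}$, and $v_i,v_j$ with $i\ne j$ are adjacent iff $[a_i,b_i]\cap[a_j,b_j]\neq\emptyset$. Let $n=\lceil\log_2 N\rceil$; the graph is given by the Boolean functions $\chi_V(x)=1\iff|x|<N$ and $\chi_E(x,y)=1\iff |x|,|y|<N$ and $v_{|x|},v_{|y|}$ are adjacent. All vectors of variables below have length $n$. **Functional operations.** Negation, replacement of one variable by a constant, binary synthesis $f\otimes g$, and quantification $\exists x_i$ or $\forall x_i$ over one variable are one operation each; reordering the arguments of a function of $k$ vectors of $n$ variables counts as $3(k-1)n$ operations (all functions are regarded as functions of a fixed finite list of vectors). Comparisons such as $|x|\le|y|$ or $|z|-|x|=|l|$ are threshold functions $\sum_j w_j|x^{(j)}|\ge T$ with $w_j\in\{-1,0,1\}$ (an equation is a conjunction of two of them); the construction of a threshold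 function counts as one operation. **Procedures.** $TransitiveClosure(R(x,y))$: start with $R^*=R$ and perform $n+1$ times $R^*(x,y):=\exists z:R^*(x,z)\wedge R^*(z,y)$; return $R^*$. $EnumerateOrder(O(x,y))$: let $DS(x,y)=O(x,y)\wedge\overline{\exists z:O(x,z)\wedge O(z,y)}$ and $EO_0(x,y,l)=(|l|=0\wedge|x|=|y|)\vee(|l|=1\wedge DS(x,y))$; for $i=1,\dots,n$ let $$EO_i(x,y,l)=(|l|\le2^{i-1}\wedge EO_{i-1}(x,y,l))\vee\bigl[2^{i-1}<|l|\le2^i\wedge\exists l_1,z:EO_{i-1}(x,z,2^{i-1})\wedge EO_{i-1}(z,y,l_1)\wedge|l_1|+2^{i-1}=|l|\bigr];$$ return the function $\exists z:EO_n(z,x,l)\wedge\overline{\exists z':O(z',z)}$ of $(x,l)$. **Algorithm.** Compute successively 1. $\chi_{E^c}(x,y)=\chi_V(x)\wedge\chi_V(y)\wedge\overline{\chi_E(x,y)}\wedge|x|\ne|y|$; 2. $H(x,y,x',y')=|x|\le|x'|\wedge|y|\le|y'|\wedge(\chi_E(x,x')\vee|x|=|x'|)\wedge(\chi_E(y,y')\vee|y|=|y'|)$;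 3. $EO(x,y)=\exists x',y':H(x,y,x',y')\wedge\bigl(|x'|<|y'|\vee(|x'|=|y'|\wedge|x|<|y|)\bigr)\wedge\overline{\exists x'',y'':H(x,y,x'',y'')\wedge(|x''|>|x'|\vee|y''|>|y'|)}$; 4. $EEO(x,l)=EnumerateOrder(EO(x,y))$; 5. $H_1(x,y,z)=\overline{EO(z,x)}\wedge EO(z,y)\wedge\chi_{E^c}(z,y)$ and $H_2(x,y,z)=|x|<|z|\le|y|\wedge\chi_{E^c}(x,z)$; 6. $RE(x,y,l)=|x|<|y|\wedge\bigl[\exists z,l_1,l_2:H_1(x,y,z)\wedge EEO(x,l_1)\wedge EEO(z,l_2)\wedge|l_2|-|l_1|=|l|\wedge\overline{\exists z':H_1(x,y,z')\wedge EO(z,z')}\bigr]$; 7. $LE(x,y,l)=|x|\le|y|\wedge\bigl[\exists z:H_2(x,y,z)\wedge|y|-|z|=|l|\wedge\overline{\exists z':H_2(x,y,z')\wedge|z'|<|z|}\bigr]$; 8. $RELATED(x,y)=\exists l:RE(x,y,l)\wedge LE(x,y,l)\wedge\overline{\exists z,l':|z|<|y|\wedge RE(x,z,l')\wedge LE(x,z,l')}$;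 9. $SAMECOLOR(x,y)=TransitiveClosure(RELATED(x,y)\vee|x|=|y|)$; 10. $FIRST(x)=\overline{\exists x':SAMECOLOR(x',x)\wedge|x'|<|x|}$; 11. $COLORORDER(x,y)=\exists x',y':SAMECOLOR(x',x)\wedge FIRST(x')\wedge SAMECOLOR(y',y)\wedge FIRST(y')\wedge|x'|<|y'|$; 12. output $COLOR(x,l)=EnumerateOrder(COLORORDER(x,y))$. **Theorem.** For every such family of intervals the output is a proper coloring of $G$ with the minimal number of colors: there is a proper coloring $C:V\to\{0,\dots,k-1\}$, $k=\chi(G)$ the chromatic number of $G$, such that for all $x,l\in\{0,1\}^n$ with $|x|<N$ one has $COLOR(x,l)=1$ iff $|l|=C(v_{|x|})$. The algorithm uses $O(\log^2N)$ functional operations. -/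

import Mathlib

/-!
Implicit (OBDD-style) algorithms: Boolean functions on named vectors of `n` bits, the functional
operations on them with their operation count, straight-line programs built from these operations,
and the implicit coloring algorithm for interval graphs as such a program.
-/

namespace ImplicitColoring

/-! ### Boolean functions -/

/-- The names of the input variable vectors. Each of them has `n` bits; `x1`, `x2` play the roles
of `x'`, `x''`, and so on. -/
inductive Vec : Type
  | x | y | z | l | x1 | y1 | z1 | l1 | x2 | y2 | l2
  deriving DecidableEq

instance : Fintype Vec where
  elems := {.x, .y, .z, .l, .x1, .y1, .z1, .l1, .x2, .y2, .l2}
  complete v := by cases v <;> decide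

/-- The value `|b| = ∑ i, b_i 2 ^ i` of a binary number of length `n`. -/
def bval {n : ℕ} (b : Fin n → Bool) : ℕ :=
  ∑ i : Fin n, if b i then 2 ^ (i : ℕ) else 0

/-- The binary number of length `n` of (the residue modulo `2 ^ n` of) a natural number. -/
def bits (n : ℕ) (c : ℕ) : Fin n → Bool := fun i => c.testBit i

/-- An assignment of all input bits. -/
abbrev Assign (n : ℕ) : Type := Vec → Fin n → Bool

/-- A Boolean function of the input variable vectors. -/
abbrev BoolFun (n : ℕ) : Type := Assign n → Bool

/-- The assignment in which bit `i` of vector `v` is replaced by `c`. -/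
def setBit {n : ℕ} (σ : Assign n) (v : Vec) (i : Fin n) (c : Bool) : Assign n :=
  Function.update σ v (Function.update (σ v) i c)

/-! ### Functional operations and programs -/

/-- The program variables; each one stores a Boolean function. -/
inductive Reg : Type
  | chiE | chiV | compl
  | H | EO | EEO
  | H1 | H2 | RE | LE
  | related | sameColor | first | colorOrder | color
  | DS | EOi
  deriving DecidableEq

/-- Right-hand sides of assignments: terms built from stored functions and multivariate threshold
functions by the functional operations. -/
inductive Expr (n : ℕ) : Type
  /-- a stored function -/
  | reg (r : Reg) : Expr n
  /-- the multivariate threshold function `∑ v, w v * |v| ≥ T` with weights in `{-1, 0, 1}` -/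
  | threshold (w : Vec → SignType) (T : ℤ) : Expr n
  /-- negation -/
  | neg (e : Expr n) : Expr n
  /-- replacement of one variable by a constant -/
  | restrict (v : Vec) (i : Fin n) (c : Bool) (e : Expr n) : Expr n
  /-- synthesis with a binary Boolean operation -/
  | synth (op : Bool → Bool → Bool) (e f : Expr n) : Expr n
  /-- existential quantification over one variable -/
  | exBit (v : Vec) (i : Fin n) (e : Expr n) : Expr n
  /-- universal quantification over one variable -/
  | allBit (v : Vec) (i : Fin n) (e : Expr n) : Expr n
  /-- argument reordering by a permutation of the variable vectors -/
  | reorder (ρ : Equiv.Perm Vec) (e : Expr n) : Expr n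

/-- The contents of the program variables. -/
abbrev Env (n : ℕ) : Type := Reg → BoolFun n

/-- The Boolean function computed by a term. -/
def Expr.eval {n : ℕ} (env : Env n) : Expr n → BoolFun n
  | .reg r => env r
  | .threshold w T => fun σ => decide (T ≤ ∑ v : Vec, ((w v : SignType) : ℤ) * (bval (σ v) : ℤ))
  | .neg e => fun σ => !(e.eval env σ)
  | .restrict v i c e => fun σ => e.eval env (setBit σ v i c)
  | .synth op e f => fun σ => op (e.eval env σ) (f.eval env σ)
  | .exBit v i e => fun σ => e.eval env (setBit σ v i false) || e.eval env (setBit σ v i true)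
  | .allBit v i e => fun σ => e.eval env (setBit σ v i false) && e.eval env (setBit σ v i true)
  | .reorder ρ e => fun σ => e.eval env (fun v => σ (ρ v))

/-- The number of functional operations used to compute a term. Negation, replacement by a
constant, synthesis and quantification over one variable count as one operation each; an argument
reordering of `k` vectors of `n` variables counts as `3 (k - 1) n` operations; the direct
construction of a threshold function is also charged, as one operation. -/
def Expr.cost {n : ℕ} : Expr n → ℕ
  | .reg _ => 0
  | .threshold _ _ => 1
  | .neg e => e.cost + 1
  | .restrict _ _ _ e => e.cost + 1
  | .synth _ e f => e.cost + f.cost + 1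
  | .exBit _ _ e => e.cost + 1
  | .allBit _ _ e => e.cost + 1
  | .reorder _ e => e.cost + 3 * (Fintype.card Vec - 1) * n

/-- The assignment `target := value`. -/
structure Stmt (n : ℕ) : Type where
  target : Reg
  value : Expr n

/-- A program (with its loops unrolled) is a list of assignments. -/
abbrev Prog (n : ℕ) : Type := List (Stmt n)

/-- Execution of a program. -/
def Prog.run {n : ℕ} : Prog n → Env n → Env n
  | [], env => env
  | s :: p, env => Prog.run p (Function.update env s.target (s.value.eval env))

/-- The number of functional operations a program uses. -/
def Prog.cost {n : ℕ} (p : Prog n) : ℕ := (p.map fun s => s.value.cost).sum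

/-! ### Abbreviations for terms -/

section Terms

variable {n : ℕ}

/-- conjunction -/
def Expr.and (e f : Expr n) : Expr n := .synth (fun a b => a && b) e f

/-- disjunction -/
def Expr.or (e f : Expr n) : Expr n := .synth (fun a b => a || b) e f

/-- `∃ v : e`, quantification over all `n` bits of the vector `v`. -/
def Expr.ex (v : Vec) (e : Expr n) : Expr n :=
  (List.finRange n).foldr (fun i f => .exBit v i f) e

/-- Replacement of all bits of the vector `v` by those of the binary number of `c`. -/
def Expr.subst (v : Vec) (c : ℕ) (e : Expr n) : Expr n :=
  (List.finRange n).foldr (fun i f => .restrict v i (bits n c i) f) e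

/-- For pairs with distinct first and distinct second components, a permutation that maps every
first component to the second one. -/
def argPerm (s : List (Vec × Vec)) : Equiv.Perm Vec :=
  s.foldl (fun ρ p => Equiv.swap (ρ p.1) p.2 * ρ) 1

/-- The stored function `r` with some arguments renamed: `call r [(x, u), (y, v)]` is `r(u, v)` for
a function `r(x, y)`. -/
def call (r : Reg) (s : List (Vec × Vec)) : Expr n := .reorder (argPerm s) (.reg r)

/-- `∑ v ∈ pos, |v| - ∑ v ∈ neg, |v| ≥ T`, for disjoint lists without repetitions. -/
def geq (pos neg : List Vec) (T : ℤ) : Expr n :=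
  .threshold (fun v => if v ∈ pos then 1 else if v ∈ neg then -1 else 0) T

/-- `∑ v ∈ pos, |v| - ∑ v ∈ neg, |v| = T`, a conjunction of two threshold functions. -/
def eqn (pos neg : List Vec) (T : ℤ) : Expr n := .and (geq pos neg T) (geq neg pos (-T))

/-- `|u| ≤ |v|` -/
def le (u v : Vec) : Expr n := geq [v] [u] 0

/-- `|u| < |v|` -/
def lt (u v : Vec) : Expr n := geq [v] [u] 1

/-- `|u| = |v|` -/
def eq (u v : Vec) : Expr n := eqn [u] [v] 0

end Terms

/-! ### The algorithms -/

section Algorithms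

open Vec Reg

/-- `out(x, y) := TransitiveClosure(R(x, y))`, by iterative squaring. -/
def transitiveClosure (n : ℕ) (R : Expr n) (out : Reg) : Prog n :=
  ⟨out, R⟩ ::
  (List.range (n + 1)).map fun _ =>
    -- out(x, y) := ∃ z : out(x, z) ∧ out(z, y)
    ⟨out, .ex z (.and (call out [(y, z)]) (call out [(x, z)]))⟩

/-- `out(x, l) := EnumerateOrder(O(x, y))`: `out(x, l) = 1` iff `x` has rank `|l|` in the strict
order `O`. -/
def enumerateOrder (n : ℕ) (O out : Reg) : Prog n :=
  -- DS(x, y) := O(x, y) ∧ ¬ ∃ z : O(x, z) ∧ O(z, y)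
  [⟨DS, .and (.reg O) (.neg (.ex z (.and (call O [(y, z)]) (call O [(x, z)]))))⟩,
  -- EO_0(x, y, l) := (|l| = 0 ∧ |x| = |y|) ∨ (|l| = 1 ∧ DS(x, y))
   ⟨EOi, .or (.and (eqn [l] [] 0) (eq x y)) (.and (eqn [l] [] 1) (.reg DS))⟩] ++
  -- for j = i - 1 = 0, ..., n - 1:
  -- EO_i(x, y, l) := (|l| ≤ 2^j ∧ EO_j(x, y, l)) ∨ (2^j < |l| ≤ 2^(j+1) ∧
  --   ∃ l1, z : EO_j(x, z, 2^j) ∧ EO_j(z, y, l1) ∧ |l1| + 2^j = |l|)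
  ((List.range n).map fun j =>
    ⟨EOi, .or
      (.and (geq [] [l] (-(2 ^ j))) (.reg EOi))
      (.and (.and (geq [l] [] (2 ^ j + 1)) (geq [] [l] (-(2 ^ (j + 1)))))
        (.ex l1 (.ex z
          (.and (.and (.subst l (2 ^ j) (call EOi [(y, z)]))
                      (call EOi [(x, z), (l, l1)]))
                (eqn [l] [l1] (2 ^ j))))))⟩) ++
  -- out(x, l) := ∃ z : EO_n(z, x, l) ∧ ¬ ∃ z' : O(z', z)
  [⟨out, .ex z (.and (call EOi [(x, z), (y, x)]) (.neg (.ex z1 (call O [(x, z1), (y, z)]))))⟩]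

/-- The implicit coloring algorithm for interval graphs whose nodes are encoded by `n` bits. The
input is `chiE(x, y)` and `chiV(x)`, the output is `color(x, l)`. -/
def coloringAlgorithm (n : ℕ) : Prog n :=
  -- compl(x, y) := chiV(x) ∧ chiV(y) ∧ ¬ chiE(x, y) ∧ |x| ≠ |y|
  [⟨compl, .and (.and (.and (.reg chiV) (call chiV [(x, y)])) (.neg (.reg chiE)))
    (.neg (eq x y))⟩,
  -- H(x, y, x', y') := |x| ≤ |x'| ∧ |y| ≤ |y'| ∧ (chiE(x, x') ∨ |x| = |x'|)
  --   ∧ (chiE(y, y') ∨ |y| = |y'|)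
   ⟨H, .and (.and (.and (le x x1) (le y y1)) (.or (call chiE [(y, x1)]) (eq x x1)))
    (.or (call chiE [(x, y), (y, y1)]) (eq y y1))⟩,
  -- EO(x, y) := ∃ x', y' : H(x, y, x', y') ∧ (|x'| < |y'| ∨ (|x'| = |y'| ∧ |x| < |y|))
  --   ∧ ¬ ∃ x'', y'' : H(x, y, x'', y'') ∧ (|x''| > |x'| ∨ |y''| > |y'|)
   ⟨EO, .ex x1 (.ex y1 (.and
    (.and (.reg H) (.or (lt x1 y1) (.and (eq x1 y1) (lt x y))))
    (.neg (.ex x2 (.ex y2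
      (.and (call H [(x1, x2), (y1, y2)]) (.or (lt x1 x2) (lt y1 y2))))))))⟩] ++
  -- EEO(x, l) := EnumerateOrder(EO(x, y))
  enumerateOrder n EO EEO ++
  -- H1(x, y, z) := ¬ EO(z, x) ∧ EO(z, y) ∧ compl(z, y)
  [⟨H1, .and (.and (.neg (call EO [(x, z), (y, x)])) (call EO [(x, z)])) (call compl [(x, z)])⟩,
  -- H2(x, y, z) := |x| < |z| ≤ |y| ∧ compl(x, z)
   ⟨H2, .and (.and (lt x z) (le z y)) (call compl [(y, z)])⟩,
  -- RE(x, y, l) := |x| < |y| ∧ ∃ z, l1, l2 : H1(x, y, z) ∧ EEO(x, l1) ∧ EEO(z, l2)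
  --   ∧ |l2| - |l1| = |l| ∧ ¬ ∃ z' : H1(x, y, z') ∧ EO(z, z')
   ⟨RE, .and (lt x y) (.ex z (.ex l1 (.ex l2 (.and
    (.and (.and (.and (.reg H1) (call EEO [(l, l1)])) (call EEO [(x, z), (l, l2)]))
      (eqn [l2] [l1, l] 0))
    (.neg (.ex z1 (.and (call H1 [(z, z1)]) (call EO [(x, z), (y, z1)]))))))))⟩,
  -- LE(x, y, l) := |x| ≤ |y| ∧ ∃ z : H2(x, y, z) ∧ |y| - |z| = |l|
  --   ∧ ¬ ∃ z' : H2(x, y, z') ∧ |z'| < |z|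
   ⟨LE, .and (le x y) (.ex z (.and
    (.and (.reg H2) (eqn [y] [z, l] 0))
    (.neg (.ex z1 (.and (call H2 [(z, z1)]) (lt z1 z))))))⟩,
  -- related(x, y) := ∃ l : RE(x, y, l) ∧ LE(x, y, l)
  --   ∧ ¬ ∃ z, l' : |z| < |y| ∧ RE(x, z, l') ∧ LE(x, z, l')
   ⟨related, .ex l (.and (.and (.reg RE) (.reg LE))
    (.neg (.ex z (.ex l1 (.and (.and (lt z y) (call RE [(y, z), (l, l1)]))
      (call LE [(y, z), (l, l1)]))))))⟩] ++
  -- sameColor(x, y) := TransitiveClosure(related(x, y) ∨ |x| = |y|)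
  transitiveClosure n (.or (.reg related) (eq x y)) sameColor ++
  -- first(x) := ¬ ∃ x' : sameColor(x', x) ∧ |x'| < |x|
  [⟨first, .neg (.ex x1 (.and (call sameColor [(x, x1), (y, x)]) (lt x1 x)))⟩,
  -- colorOrder(x, y) := ∃ x', y' : sameColor(x', x) ∧ first(x')
  --   ∧ sameColor(y', y) ∧ first(y') ∧ |x'| < |y'|
   ⟨colorOrder, .ex x1 (.ex y1 (.and (.and (.and (.and
    (call sameColor [(x, x1), (y, x)]) (call first [(x, x1)]))
    (call sameColor [(x, y1)])) (call first [(x, y1)]))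
    (lt x1 y1)))⟩] ++
  -- color(x, l) := EnumerateOrder(colorOrder(x, y))
  enumerateOrder n colorOrder color

end Algorithms

/-! ### Interval graphs -/

/-- The interval graph of the intervals `[a i, b i]`: distinct nodes are adjacent iff their
intervals intersect. -/
def intervalGraph {N : ℕ} (a b : Fin N → ℝ) : SimpleGraph (Fin N) where
  Adj i j := i ≠ j ∧ (Set.Icc (a i) (b i) ∩ Set.Icc (a j) (b j)).Nonempty
  symm := ⟨fun _ _ h => ⟨h.1.symm, by rw [Set.inter_comm]; exact h.2⟩⟩
  loopless := ⟨fun _ h => h.1 rfl⟩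

open Classical in
/-- The input of the algorithm for a graph with nodes `0, ..., N - 1`: the characteristic functions
`chiE(x, y)` of the edge set and `chiV(x)` of the node set. All other program variables start with
the constant function `0`. -/
noncomputable def inputEnv {N : ℕ} (G : SimpleGraph (Fin N)) (n : ℕ) : Env n
  | .chiE => fun σ => decide (∃ i j : Fin N, bval (σ .x) = i ∧ bval (σ .y) = j ∧ G.Adj i j)
  | .chiV => fun σ => decide (bval (σ .x) < N)
  | _ => fun _ => false

/-- The function `color(x, l)` that the algorithm outputs on the graph `G`, with nodes encoded by
`⌈log₂ N⌉` bits. -/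
noncomputable def output {N : ℕ} (G : SimpleGraph (Fin N)) (x l : Fin (Nat.clog 2 N) → Bool) :
    Bool :=
  (coloringAlgorithm (Nat.clog 2 N)).run (inputEnv G (Nat.clog 2 N)) .color
    fun v => if v = .x then x else if v = .l then l else fun _ => false

end ImplicitColoring

/-! Write M = 2^n and let `r i` be the last node adjacent or equal to node `i`. As left endpoints
are sorted, `r` determines the graph. Sweep over all endpoints, placing the right endpoint of `i`
after left endpoint `r i` and before left endpoint `r i + 1`, with ties broken by index. Read right
endpoints as opening brackets (a color is released) and left endpoints as closing brackets (a color
is requested). `Balanced` says that the stretch from the right endpoint of `i` to the left endpoint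
of `j` has equally many of both, and `IsNext`, the least such `j`, is bracket matching: `j` takes
over the color of `i`.

Matching is injective both ways (`IsNext.right_unique`, `IsNext.left_unique`), so color classes are
chains, each with one first node. Along a chain every interval ends before the next begins, so the
coloring is proper (`lt_of_colorRank_eq`). First nodes are the unmatched closing brackets. There the
overlap, `j - numEnded j`, is larger than at every earlier node (`IsFirst.sub_lt`), so at least as
many intervals are open at `j` as there are earlier first nodes (`count_isFirst_le`). With `j`
itself they form a clique, which bounds the number of colors by the chromatic number.

The program computes exactly this: `enumerateOrder_spec` and `transitiveClosure_spec` are loop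
invariants, and `coloringAlgorithm_spec` identifies each stored function. Numbers from N to M - 1
are dummies with `r i = i`: their right endpoints come last and each is a class by itself. For the
cost, O(n) operations occur outside the loops, and the loops have O(n) rounds of O(n) operations. -/

namespace ImplicitColoring

open Vec Reg

/-! ### Binary numbers -/

theorem bval_eq_ofBits {n : ℕ} (b : Fin n → Bool) : bval b = Nat.ofBits b := by
  induction n with
  | zero => simp [bval]
  | succ n ih =>
    rw [Nat.ofBits_succ, ← ih, bval, Fin.sum_univ_succ, bval, Finset.mul_sum, add_comm]
    congr 1
    · refine Finset.sum_congr rfl fun i _ => ?_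
      simp only [Function.comp_apply, Fin.val_succ, pow_succ', mul_ite, mul_zero]
    · cases b 0 <;> simp

theorem bval_lt {n : ℕ} (b : Fin n → Bool) : bval b < 2 ^ n :=
  bval_eq_ofBits b ▸ Nat.ofBits_lt_two_pow b

theorem bval_bits {n c : ℕ} (h : c < 2 ^ n) : bval (bits n c) = c := by
  rw [bval_eq_ofBits]
  exact (Nat.ofBits_testBit c n).trans (Nat.mod_eq_of_lt h)

@[simp] theorem bval_bits_fin {n : ℕ} (k : Fin (2 ^ n)) : bval (bits n k) = k := bval_bits k.2

theorem bits_bval {n : ℕ} (b : Fin n → Bool) : bits n (bval b) = b := by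
  funext i
  rw [bval_eq_ofBits]
  exact Nat.testBit_ofBits_lt b i i.2

/-! ### Evaluation of terms -/

section Eval

variable {n : ℕ} (env : Env n) (σ : Assign n)

@[simp] theorem eval_reg (r : Reg) : (Expr.reg r).eval env σ = env r σ := rfl

@[simp] theorem eval_neg (e : Expr n) :
    (Expr.neg e).eval env σ = true ↔ ¬ e.eval env σ = true := by
  simp [Expr.eval]

@[simp] theorem eval_and (e f : Expr n) :
    (Expr.and e f).eval env σ = true ↔ e.eval env σ = true ∧ f.eval env σ = true := by
  simp [Expr.and, Expr.eval]

@[simp] theorem eval_or (e f : Expr n) :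
    (Expr.or e f).eval env σ = true ↔ e.eval env σ = true ∨ f.eval env σ = true := by
  simp [Expr.or, Expr.eval]

@[simp] theorem eval_call (r : Reg) (s : List (Vec × Vec)) :
    (call r s).eval env σ = env r fun v => σ (argPerm s v) := rfl

/-- Generalized to partial lists for the induction: bits in `L` are free, all others are frozen at
their value in `σ`. -/
theorem eval_foldr_exBit (v : Vec) (e : Expr n) (L : List (Fin n)) :
    (L.foldr (fun i f => Expr.exBit v i f) e).eval env σ = true ↔
      ∃ b : Fin n → Bool, (∀ i, i ∉ L → b i = σ v i) ∧
        e.eval env (Function.update σ v b) = true := by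
  induction L generalizing σ with
  | nil =>
    refine ⟨fun h => ⟨σ v, fun _ _ => rfl, by simpa using h⟩, ?_⟩
    rintro ⟨b, hb, h⟩
    have : b = σ v := funext fun i => hb i (by simp)
    simpa [this] using h
  | cons i L ih =>
    have key : ((i :: L).foldr (fun i f => Expr.exBit v i f) e).eval env σ = true ↔
        ∃ c, (L.foldr (fun i f => Expr.exBit v i f) e).eval env (setBit σ v i c) = true := by
      simp [Expr.eval]
    rw [key]
    simp only [ih, setBit, Function.update_idem, Function.update_self]
    constructor
    · rintro ⟨c, b, hb, h⟩
      refine ⟨b, fun j hj => ?_, h⟩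
      rw [List.mem_cons, not_or] at hj
      rw [hb j hj.2, Function.update_of_ne hj.1]
    · rintro ⟨b, hb, h⟩
      refine ⟨b i, b, fun j hj => ?_, h⟩
      rcases eq_or_ne j i with rfl | hji
      · simp
      · rw [Function.update_of_ne hji, hb j (by simp [hji, hj])]

-- Quantifying over `Fin (2 ^ n)` instead of bit vectors turns the later goals into arithmetic.
@[simp] theorem eval_ex (v : Vec) (e : Expr n) :
    (Expr.ex v e).eval env σ = true ↔
      ∃ k : Fin (2 ^ n), e.eval env (Function.update σ v (bits n k)) = true := by
  rw [Expr.ex, eval_foldr_exBit]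
  constructor
  · rintro ⟨b, -, h⟩
    exact ⟨⟨bval b, bval_lt b⟩, by simpa [bits_bval] using h⟩
  · rintro ⟨k, h⟩
    exact ⟨bits n k, fun i hi => absurd (List.mem_finRange i) hi, h⟩

theorem eval_foldr_restrict (v : Vec) (c : Fin n → Bool) (e : Expr n) (L : List (Fin n)) :
    (L.foldr (fun i f => Expr.restrict v i (c i) f) e).eval env σ =
      e.eval env (Function.update σ v fun i => if i ∈ L then c i else σ v i) := by
  induction L generalizing σ with
  | nil => simp
  | cons i L ih =>
    simp only [List.foldr_cons, Expr.eval, ih, setBit, Function.update_idem, Function.update_self]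
    congr 2
    funext j
    by_cases hj : j = i <;> simp [hj]

@[simp] theorem eval_subst (v : Vec) (c : ℕ) (e : Expr n) :
    (Expr.subst v c e).eval env σ = e.eval env (Function.update σ v (bits n c)) := by
  rw [Expr.subst, eval_foldr_restrict]
  simp

theorem eval_geq {pos neg : List Vec} (hpos : pos.Nodup) (hneg : neg.Nodup)
    (h : pos.Disjoint neg) (T : ℤ) :
    (geq pos neg T).eval env σ = true ↔
      T + ((neg.map fun v => bval (σ v)).sum : ℕ) ≤ ((pos.map fun v => bval (σ v)).sum : ℕ) := by
  have key : ∑ v : Vec, (((if v ∈ pos then 1 else if v ∈ neg then -1 else 0 : SignType)) : ℤ) *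
      (bval (σ v) : ℤ) = ((pos.map fun v => bval (σ v)).sum : ℕ) -
        ((neg.map fun v => bval (σ v)).sum : ℕ) := by
    rw [← List.sum_toFinset _ hpos, ← List.sum_toFinset _ hneg, Nat.cast_sum, Nat.cast_sum]
    have hsum (s : Finset Vec) (f : Vec → ℤ) : ∑ v ∈ s, f v = ∑ v, if v ∈ s then f v else 0 := by
      simp [Finset.sum_ite_mem]
    rw [hsum pos.toFinset, hsum neg.toFinset, ← Finset.sum_sub_distrib]
    refine Finset.sum_congr rfl fun v _ => ?_
    by_cases h1 : v ∈ pos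
    · have h2 : v ∉ neg := fun h2 => h h1 h2
      simp [h1, h2]
    · by_cases h2 : v ∈ neg <;> simp [h1, h2]
  simp only [geq, Expr.eval, decide_eq_true_eq, key]
  omega

theorem eval_eqn {pos neg : List Vec} (hpos : pos.Nodup) (hneg : neg.Nodup)
    (h : pos.Disjoint neg) (T : ℤ) :
    (eqn pos neg T).eval env σ = true ↔
      (((pos.map fun v => bval (σ v)).sum : ℕ) : ℤ) =
        ((neg.map fun v => bval (σ v)).sum : ℕ) + T := by
  rw [eqn, eval_and, eval_geq _ _ hpos hneg h, eval_geq _ _ hneg hpos h.symm]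
  omega

variable {u v w : Vec}

@[simp] theorem eval_le (h : u ≠ v) :
    (le u v).eval env σ = true ↔ bval (σ u) ≤ bval (σ v) := by
  rw [le, eval_geq] <;> simp [h]

@[simp] theorem eval_lt (h : u ≠ v) :
    (lt u v).eval env σ = true ↔ bval (σ u) < bval (σ v) := by
  rw [lt, eval_geq] <;> simp [h]
  omega

@[simp] theorem eval_eq (h : u ≠ v) :
    (eq u v).eval env σ = true ↔ bval (σ u) = bval (σ v) := by
  rw [eq, eval_eqn] <;> simp [h.symm]

@[simp] theorem eval_eqn_const (c : ℤ) :
    (eqn [u] [] c).eval env σ = true ↔ (bval (σ u) : ℤ) = c := by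
  rw [eqn, eval_and, eval_geq, eval_geq] <;> simp
  omega

@[simp] theorem eval_eqn_add_const (h : u ≠ v) (c : ℤ) :
    (eqn [u] [v] c).eval env σ = true ↔ (bval (σ u) : ℤ) = bval (σ v) + c := by
  rw [eval_eqn] <;> simp [h.symm]

@[simp] theorem eval_eqn_add (huv : u ≠ v) (huw : u ≠ w) (hvw : v ≠ w) :
    (eqn [u] [v, w] 0).eval env σ = true ↔ bval (σ u) = bval (σ v) + bval (σ w) := by
  rw [eval_eqn] <;> simp [huv, huw, hvw]
  omega

@[simp] theorem eval_geq_const (c : ℤ) :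
    (geq [u] [] c).eval env σ = true ↔ c ≤ bval (σ u) := by
  rw [eval_geq] <;> simp

@[simp] theorem eval_leq_const (c : ℤ) :
    (geq [] [u] (-c)).eval env σ = true ↔ bval (σ u) ≤ c := by
  rw [eval_geq] <;> simp

end Eval

/-! ### Execution of programs -/

theorem run_append {n : ℕ} (p q : Prog n) (env : Env n) :
    Prog.run (p ++ q) env = Prog.run q (Prog.run p env) := by
  induction p generalizing env with
  | nil => rfl
  | cons s p ih => exact ih _

theorem run_cons {n : ℕ} (s : Stmt n) (p : Prog n) (env : Env n) :
    Prog.run (s :: p) env = Prog.run p (Function.update env s.target (s.value.eval env)) := rfl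

theorem run_nil {n : ℕ} (env : Env n) : Prog.run [] env = env := rfl

/-- An invariant of a loop holds when the loop ends. -/
theorem run_map_range {n : ℕ} (f : ℕ → Stmt n) (I : ℕ → Env n → Prop) (k : ℕ) (env : Env n)
    (h0 : I 0 env)
    (hs : ∀ m < k, ∀ env, I m env →
      I (m + 1) (Function.update env (f m).target ((f m).value.eval env))) :
    I k (Prog.run ((List.range k).map f) env) := by
  induction k with
  | zero => exact h0
  | succ k ih =>
    rw [List.range_succ, List.map_append, run_append]
    exact hs k k.lt_succ_self _ (ih fun m hm => hs m (hm.trans k.lt_succ_self))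

theorem run_apply_of_forall_ne {n : ℕ} {r : Reg} (p : Prog n) (h : ∀ s ∈ p, r ≠ s.target)
    (env : Env n) : Prog.run p env r = env r := by
  induction p generalizing env with
  | nil => rfl
  | cons s p ih =>
    rw [run_cons, ih fun s hs => h s (List.mem_cons_of_mem _ hs),
      Function.update_of_ne (h s List.mem_cons_self)]

/-! ### Order enumeration and transitive closure -/

theorem enumerateOrder_frame {n : ℕ} {O out r : Reg} (h1 : r ≠ DS) (h2 : r ≠ EOi) (h3 : r ≠ out)
    (env : Env n) : Prog.run (enumerateOrder n O out) env r = env r := by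
  apply run_apply_of_forall_ne
  simp only [enumerateOrder, List.mem_append, List.mem_cons, List.not_mem_nil, or_false,
    List.mem_map]
  rintro s (((rfl | rfl) | ⟨_, _, rfl⟩) | rfl) <;> assumption

/-- The program `enumerateOrder` computes the rank function of a strict weak order. -/
theorem enumerateOrder_spec {n : ℕ} {O out : Reg} (hDS : O ≠ DS) (hEO : O ≠ EOi) (env : Env n)
    (ρ : ℕ → ℕ) (hO : ∀ σ, env O σ = true ↔ ρ (bval (σ x)) < ρ (bval (σ y)))
    (hρ : ∀ k < 2 ^ n, ∀ j < ρ k, ∃ i < 2 ^ n, ρ i = j) (σ : Assign n) :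
    Prog.run (enumerateOrder n O out) env out σ = true ↔ ρ (bval (σ x)) = bval (σ l) := by
  unfold enumerateOrder
  simp only [run_append, run_cons, run_nil]
  set env1 := Function.update env DS _ with h1
  have hO1 : ∀ σ, env1 O σ = true ↔ ρ (bval (σ x)) < ρ (bval (σ y)) := by
    intro σ
    rw [h1, Function.update_of_ne hDS, hO]
  -- All ranks below an attained one are attained, so a rank gap of two or more contains an
  -- intermediate element.
  have hDS1 : ∀ σ, env1 DS σ = true ↔ ρ (bval (σ y)) = ρ (bval (σ x)) + 1 := by
    intro σ
    rw [h1]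
    simp [hO, argPerm, Equiv.swap_apply_def, Function.update_apply]
    constructor
    · rintro ⟨h, h'⟩
      by_contra hne
      obtain ⟨i, hi, hi'⟩ := hρ _ (bval_lt (σ y)) (ρ (bval (σ x)) + 1) (by omega)
      have := h' ⟨i, hi⟩
      simp only [hi'] at this
      omega
    · intro h
      refine ⟨by omega, fun i => by omega⟩
  clear_value env1
  set env2 := Function.update env1 EOi _ with h2
  have hO2 : ∀ σ, env2 O σ = true ↔ ρ (bval (σ x)) < ρ (bval (σ y)) := by
    intro σ
    rw [h2, Function.update_of_ne hEO, hO1]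
  -- Since `O` is only a weak order, distance 0 means equality of the numbers, while positive
  -- distances depend on ranks alone.
  have hE2 : ∀ σ, bval (σ l) ≤ 2 ^ 0 → (env2 EOi σ = true ↔ 
      (bval (σ l) = 0 ∧ bval (σ x) = bval (σ y)) ∨
        (0 < bval (σ l) ∧ ρ (bval (σ y)) = ρ (bval (σ x)) + bval (σ l))) := by
    intro σ hl
    rw [h2]
    simp only [Function.update_self, eval_or, eval_and, eval_eqn_const, eval_reg, hDS1, ne_eq,
      reduceCtorEq, not_false_eq_true, eval_eq]
    omega
  clear_value env2
  have step : ∀ env3 : Env n, (∀ σ, env3 O σ = true ↔ ρ (bval (σ x)) < ρ (bval (σ y))) →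
      (∀ σ, bval (σ l) ≤ 2 ^ n → (env3 EOi σ = true ↔
        (bval (σ l) = 0 ∧ bval (σ x) = bval (σ y)) ∨
          (0 < bval (σ l) ∧ ρ (bval (σ y)) = ρ (bval (σ x)) + bval (σ l)))) →
      ((Expr.ex z (.and (call EOi [(x, z), (y, x)])
        (.neg (.ex z1 (call O [(x, z1), (y, z)]))))).eval env3 σ = true ↔
          ρ (bval (σ x)) = bval (σ l)) := by
    intro env3 hO3 hE3
    have hl := bval_lt (σ l)
    simp [argPerm, Equiv.swap_apply_def, Function.update_apply, hE3, hO3, hl.le]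
    constructor
    · rintro ⟨k, hk, hmin⟩
      -- An element without predecessor has rank 0, because rank 0 is attained.
      have h0 : ρ k = 0 := by
        by_contra h0
        obtain ⟨i, hi, hi'⟩ := hρ k k.2 0 (by omega)
        have := hmin ⟨i, hi⟩
        simp only [hi'] at this
        omega
      rcases hk with ⟨hk, hk'⟩ | ⟨-, hk⟩
      · rw [← hk', h0, hk]
      · rw [hk, h0, zero_add]
    · intro h
      rcases Nat.eq_zero_or_pos (bval (σ l)) with h0 | h0
      · exact ⟨⟨_, bval_lt (σ x)⟩, .inl ⟨h0, rfl⟩, fun i => by simp only [h, h0, Nat.zero_le]⟩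
      · obtain ⟨i, hi, hi'⟩ := hρ _ (bval_lt (σ x)) 0 (by omega)
        exact ⟨⟨i, hi⟩, .inr ⟨h0, by simp only [hi', h, zero_add]⟩, fun j => by
          simp only [hi', Nat.zero_le]⟩
  rw [Function.update_self]
  refine (fun h => step _ h.1 h.2) (run_map_range _ (fun m env3 =>
    (∀ σ, env3 O σ = true ↔ ρ (bval (σ x)) < ρ (bval (σ y))) ∧
      ∀ σ, bval (σ l) ≤ 2 ^ m → (env3 EOi σ = true ↔
        (bval (σ l) = 0 ∧ bval (σ x) = bval (σ y)) ∨
          (0 < bval (σ l) ∧ ρ (bval (σ y)) = ρ (bval (σ x)) + bval (σ l)))) n env2 ⟨hO2, hE2⟩ ?_)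
  rintro m hm env3 ⟨hO3, hE3⟩
  constructor
  · intro σ
    rw [Function.update_of_ne hEO, hO3]
  · intro σ hσ
    -- The constant substituted for `l` fits into `n` bits because `m < n`.
    have hpow : 2 ^ m < 2 ^ n := Nat.pow_lt_pow_right one_lt_two (by omega)
    have h1 : ∀ τ : Assign n, bval (τ l) = 2 ^ m →
        (env3 EOi τ = true ↔ ρ (bval (τ y)) = ρ (bval (τ x)) + 2 ^ m) := by
      intro τ hτ
      have : 0 < 2 ^ m := by positivity
      rw [hE3 τ hτ.le, hτ]
      omega
    simp [argPerm, Equiv.swap_apply_def, Function.update_apply, h1, bval_bits hpow]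
    constructor
    · rintro (⟨hl, h⟩ | ⟨⟨hl, -⟩, k, ⟨w, hw, h⟩, hk⟩)
      · exact (hE3 σ (by exact_mod_cast hl)).1 h
      · have hk' : bval (σ l) = k + 2 ^ m := by exact_mod_cast hk
        rw [hE3 _ (by simp; omega)] at h
        simp [-Fin.val_eq_zero_iff] at h
        have hl' : 2 ^ m < bval (σ l) := by exact_mod_cast hl
        omega
    · intro h
      by_cases hl : bval (σ l) ≤ 2 ^ m
      · exact .inl ⟨by exact_mod_cast hl, (hE3 σ hl).2 h⟩
      · have hlt := bval_lt (σ l)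
        -- The midpoint: its rank lies strictly below that of `y`, since the remaining distance is
        -- positive.
        obtain ⟨i, hi, hi'⟩ := hρ _ (bval_lt (σ y)) (ρ (bval (σ x)) + 2 ^ m) (by omega)
        have hk : bval (σ l) - 2 ^ m < 2 ^ n := by omega
        refine .inr ⟨⟨by exact_mod_cast not_le.1 hl, by exact_mod_cast hσ⟩,
          ⟨bval (σ l) - 2 ^ m, hk⟩, ⟨⟨i, hi⟩, hi', ?_⟩, ?_⟩
        · rw [hE3 _ (by simp [bval_bits hk]; omega)]
          simp [bval_bits hk, bval_bits hi, hi']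
          omega
        · simp only
          push_cast [not_le.1 hl |>.le]
          ring

/-- There is a walk from `i` to `j` with (at most) `L` steps in the reflexive relation `S`. -/
def HasWalk (S : ℕ → ℕ → Prop) (L i j : ℕ) : Prop :=
  ∃ p : ℕ → ℕ, p 0 = i ∧ (∀ t, L ≤ t → p t = j) ∧ ∀ t, S (p t) (p (t + 1))

namespace HasWalk

variable {S : ℕ → ℕ → Prop} {L L' i j k : ℕ}

theorem one_iff (hrefl : ∀ i, S i i) : HasWalk S 1 i j ↔ S i j := by
  constructor
  · rintro ⟨p, rfl, h1, hp⟩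
    simpa [h1 1 le_rfl] using hp 0
  · intro h
    refine ⟨fun t => if t = 0 then i else j, by simp, fun t ht => if_neg (by omega), fun t => ?_⟩
    rcases Nat.eq_zero_or_pos t with rfl | ht
    · simpa
    · simpa [ht.ne'] using hrefl j

theorem mono (h : HasWalk S L i j) (hL : L ≤ L') : HasWalk S L' i j :=
  let ⟨p, h0, h1, hp⟩ := h
  ⟨p, h0, fun t ht => h1 t (hL.trans ht), hp⟩

theorem le (hS : ∀ i j, S i j → i ≤ j) (h : HasWalk S L i j) : i ≤ j := by
  obtain ⟨p, rfl, h1, hp⟩ := h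
  rw [← h1 L le_rfl]
  exact monotone_nat_of_le_succ (fun t => hS _ _ (hp t)) L.zero_le

theorem trans (h : HasWalk S L i j) (h' : HasWalk S L' j k) : HasWalk S (L + L') i k := by
  obtain ⟨p, h0, h1, hp⟩ := h
  obtain ⟨q, h0', h1', hq⟩ := h'
  refine ⟨fun t => if t ≤ L then p t else q (t - L), by simpa, fun t ht => ?_, fun t => ?_⟩
  · by_cases htL : t ≤ L
    · have ht0 : t = L := by omega
      rw [ht0]
      simp only [le_refl, if_true, h1 L le_rfl, ← h0']
      exact h1' 0 (by omega)
    · simpa [htL] using h1' _ (by omega)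
  · rcases lt_trichotomy t L with ht | rfl | ht
    · simpa [ht.le, Nat.succ_le_of_lt ht] using hp t
    · simpa [h1 t le_rfl, h0'] using hq 0
    · have h2 : t + 1 - L = t - L + 1 := by omega
      simpa [ht.not_ge, show ¬ t + 1 ≤ L by omega, h2] using hq (t - L)

/-- Cut the walk at time `L`; reflexivity lets the first half stay there forever. -/
theorem exists_of_add (hrefl : ∀ i, S i i) (h : HasWalk S (L + L') i j) :
    ∃ k, HasWalk S L i k ∧ HasWalk S L' k j := by
  obtain ⟨p, h0, h1, hp⟩ := h
  refine ⟨p L, ⟨fun t => p (min t L), by simpa, fun t ht => by simp [ht], fun t => ?_⟩,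
    ⟨fun t => p (t + L), by simp, fun t ht => h1 _ (by omega), fun t => ?_⟩⟩
  · rcases lt_or_ge t L with ht | ht
    · simpa [ht.le, Nat.succ_le_of_lt ht] using hp t
    · simpa [ht, ht.trans t.le_succ] using hrefl _
  · simpa [add_right_comm] using hp (t + L)

theorem reflTransGen (h : HasWalk S L i j) : Relation.ReflTransGen S i j := by
  obtain ⟨p, rfl, h1, hp⟩ := h
  rw [← h1 L le_rfl]
  clear h1
  induction L with
  | zero => rfl
  | succ L ih => exact ih.tail (hp L)

/-- Steps never decrease, and those that stay put can be dropped; each remaining step gains at least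
one. -/
theorem of_reflTransGen (hrefl : ∀ i, S i i) (hS : ∀ i j, S i j → i ≤ j)
    (h : Relation.ReflTransGen S i j) : HasWalk S (j - i) i j := by
  induction h with
  | refl => exact ⟨fun _ => i, rfl, fun _ _ => rfl, fun _ => hrefl i⟩
  | tail _ h2 ih =>
    rcases (hS _ _ h2).eq_or_lt with rfl | hlt
    · exact ih
    · have := ih.le hS
      exact (ih.trans ((one_iff hrefl).2 h2)).mono (by omega)

end HasWalk

/-- The program `transitiveClosure` computes the reflexive transitive closure of a reflexive
relation that respects the order of the numbers. -/
theorem transitiveClosure_spec {n : ℕ} {R : Expr n} {out : Reg} (env : Env n)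
    (S : ℕ → ℕ → Prop) (hrefl : ∀ i, S i i) (hS : ∀ i j, S i j → i ≤ j)
    (hR : ∀ σ, R.eval env σ = true ↔ S (bval (σ x)) (bval (σ y))) (σ : Assign n) :
    Prog.run (transitiveClosure n R out) env out σ = true ↔
      Relation.ReflTransGen S (bval (σ x)) (bval (σ y)) := by
  rw [transitiveClosure, run_cons]
  have step : ∀ env' : Env n, (∀ σ, env' out σ = true ↔
      HasWalk S (2 ^ (n + 1)) (bval (σ x)) (bval (σ y))) →
      (env' out σ = true ↔ Relation.ReflTransGen S (bval (σ x)) (bval (σ y))) := by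
    intro env' h
    rw [h]
    refine ⟨HasWalk.reflTransGen, fun h => (HasWalk.of_reflTransGen hrefl hS h).mono ?_⟩
    -- Walks between `n`-bit numbers need fewer than `2 ^ n` steps, so the `n + 1` squarings
    -- suffice.
    have := bval_lt (σ y)
    rw [pow_succ]
    omega
  refine step _ (run_map_range _ (fun m env' => ∀ σ, env' out σ = true ↔
    HasWalk S (2 ^ m) (bval (σ x)) (bval (σ y))) (n + 1) _ ?_ ?_)
  · intro σ
    simp [hR, HasWalk.one_iff hrefl]
  · intro m _ env' h σ
    simp [h, argPerm, Equiv.swap_apply_def, Function.update_apply]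
    rw [pow_succ, mul_two]
    constructor
    · rintro ⟨k, h1, h2⟩
      exact h1.trans h2
    · intro h
      obtain ⟨k, h1, h2⟩ := h.exists_of_add hrefl
      exact ⟨⟨k, (h2.le hS).trans_lt (bval_lt (σ y))⟩, h1, h2⟩

/-! ### The order of the right endpoints -/

/-- `r` maps every node of a graph on `0, ..., N - 1` with adjacency `E` to the last node that is
adjacent or equal to it, and the graph is an interval graph: all nodes in between are adjacent
to the former, too. -/
structure IsLastNeighbor (N : ℕ) (E : ℕ → ℕ → Prop) (r : ℕ → ℕ) : Prop where
  le_self (i : ℕ) : i ≤ r i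
  lt_of_lt {i : ℕ} : i < N → r i < N
  eq_of_le {i : ℕ} : N ≤ i → r i = i
  adj_iff (i j : ℕ) : E i j ↔ i < N ∧ j < N ∧ i ≠ j ∧ (i < j → j ≤ r i) ∧ (j < i → i ≤ r j)

/-- The rank of `i` among `0, ..., M - 1`, ordered by right endpoints. -/
def rightRank (M : ℕ) (r : ℕ → ℕ) (i : ℕ) : ℕ :=
  ((Finset.range M).filter fun k => r k < r i ∨ (r k = r i ∧ k < i)).card

/-- The number of right endpoints before the left endpoint of `j`. -/
def numEnded (M : ℕ) (r : ℕ → ℕ) (j : ℕ) : ℕ :=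
  ((Finset.range M).filter fun k => r k < j).card

/-! ### Ranks of right endpoints -/

section Rank

variable {M : ℕ} {r : ℕ → ℕ} {i j : ℕ}

theorem rightRank_lt_of_lt (hi : i < M) (h : r i < r j ∨ (r i = r j ∧ i < j)) :
    rightRank M r i < rightRank M r j := by
  apply Finset.card_lt_card
  rw [Finset.ssubset_iff_of_subset]
  · exact ⟨i, by simp [hi, h], by simp⟩
  · intro k
    simp only [Finset.mem_filter]
    rintro ⟨hk, hk'⟩
    exact ⟨hk, by omega⟩

theorem rightRank_lt_iff (hi : i < M) (hj : j < M) :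
    rightRank M r i < rightRank M r j ↔ r i < r j ∨ (r i = r j ∧ i < j) := by
  refine ⟨fun h => ?_, rightRank_lt_of_lt hi⟩
  by_contra hn
  rcases eq_or_ne i j with rfl | hij
  · exact lt_irrefl _ h
  · exact h.not_gt (rightRank_lt_of_lt hj (by omega))

theorem rightRank_lt (hi : i < M) : rightRank M r i < M := by
  conv_rhs => rw [← Finset.card_range M]
  apply Finset.card_lt_card
  rw [Finset.ssubset_iff_of_subset (Finset.filter_subset _ _)]
  exact ⟨i, by simp [hi], by simp⟩

/-- The rank is injective from `M` numbers into `M` values, hence surjective. -/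
theorem exists_rightRank_eq {t : ℕ} (ht : t < M) : ∃ i < M, rightRank M r i = t := by
  have hinj : Set.InjOn (rightRank M r) (Finset.range M) := by
    intro i hi j hj h
    simp only [Finset.coe_range, Set.mem_Iio] at hi hj
    by_contra hij
    have h1 := (rightRank_lt_iff (r := r) hi hj).not.1 (by omega)
    have h2 := (rightRank_lt_iff (r := r) hj hi).not.1 (by omega)
    omega
  have hmap : Set.MapsTo (rightRank M r) (Finset.range M) (Finset.range M) := by
    intro i hi
    simpa using rightRank_lt (by simpa using hi)
  obtain ⟨i, hi, h⟩ := Finset.surjOn_of_injOn_of_card_le _ hmap hinj le_rfl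
    (Finset.mem_coe.2 (Finset.mem_range.2 ht))
  exact ⟨i, by simpa using hi, h⟩

/-- The right endpoints before the left endpoint of `j` are the first ones. -/
theorem rightRank_lt_numEnded_iff (hi : i < M) : rightRank M r i < numEnded M r j ↔ r i < j := by
  constructor
  · intro h
    by_contra hn
    refine h.not_ge (Finset.card_le_card fun k => ?_)
    simp only [Finset.mem_filter]
    rintro ⟨hk, hk'⟩
    exact ⟨hk, by omega⟩
  · intro h
    apply Finset.card_lt_card
    rw [Finset.ssubset_iff_of_subset]
    · exact ⟨i, by simp [hi, h], by simp⟩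
    · intro k
      simp only [Finset.mem_filter]
      rintro ⟨hk, hk'⟩
      exact ⟨hk, by omega⟩

theorem numEnded_mono : Monotone (numEnded M r) := fun i j h =>
  Finset.card_le_card fun k => by
    simp only [Finset.mem_filter]
    rintro ⟨hk, hk'⟩
    exact ⟨hk, by omega⟩

theorem numEnded_le : numEnded M r j ≤ M :=
  (Finset.card_filter_le _ _).trans_eq (Finset.card_range M)

/-- Each `k < j` has either ended before `j` or is still open there, and `r k < j` forces `k < j`.
Thus `j - numEnded M r j` is the overlap at `j`. -/
theorem numEnded_add_card (hr : ∀ i, i ≤ r i) (hj : j ≤ M) :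
    numEnded M r j + ((Finset.range j).filter fun k => j ≤ r k).card = j := by
  conv_rhs => rw [← Finset.card_range j,
    ← Finset.card_filter_add_card_filter_not (s := Finset.range j) fun k => r k < j]
  simp only [not_lt, numEnded]
  congr 2
  ext k
  have := hr k
  simp only [Finset.mem_filter, Finset.mem_range]
  omega

end Rank

/-! ### The color classes -/

/-- The numbers of right endpoints and of left endpoints between `i` and `j` agree. -/
def Balanced (M N : ℕ) (r : ℕ → ℕ) (i j : ℕ) : Prop :=
  r i < j ∧ j < N ∧ numEnded M r j + r i = rightRank M r i + j

/-- `j` is the next node after `i` in the color class of `i`. -/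
def IsNext (M N : ℕ) (r : ℕ → ℕ) (i j : ℕ) : Prop :=
  Balanced M N r i j ∧ ∀ k < j, ¬ Balanced M N r i k

/-- `i` is the first node in its color class. -/
def IsFirst (M N : ℕ) (r : ℕ → ℕ) (i : ℕ) : Prop := ∀ k, ¬ IsNext M N r k i

section Classes

variable {M N : ℕ} {r : ℕ → ℕ} {i j k : ℕ}

theorem IsNext.lt (hr : ∀ i, i ≤ r i) (h : IsNext M N r i j) : i < j :=
  (hr i).trans_lt h.1.1

theorem IsNext.right_unique (h : IsNext M N r i j) (h' : IsNext M N r i k) : j = k := by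
  rcases lt_trichotomy j k with hjk | hjk | hjk
  · exact absurd h.1 (h'.2 j hjk)
  · exact hjk
  · exact absurd h'.1 (h.2 k hjk)

/-- Up to the next node in the color class of `i` there are too few left endpoints. -/
theorem IsNext.sub_lt (hi : i < M) (h : IsNext M N r i j) (h1 : r i < k) (h2 : k < j) :
    k + rightRank M r i < numEnded M r k + r i := by
  induction k, h1 using Nat.le_induction with
  | base =>
    -- Just after the right endpoint of `i`, at least that one has ended against one new left
    -- endpoint; equality would be balance.
    have h3 := (rightRank_lt_numEnded_iff (r := r) (j := r i + 1) hi).2 (Nat.lt_succ_self _)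
    have h4 := h.2 _ h2
    have h5 := h.1.2.1
    simp only [Balanced] at h4
    simp only [Nat.succ_eq_add_one] at *
    omega
  | succ k hk ih =>
    -- The left side grows by exactly one, so the strict inequality can fail only through equality,
    -- which is balance.
    have h3 := numEnded_mono (M := M) (r := r) k.le_succ
    have h4 := h.2 _ h2
    have h5 := h.1.2.1
    have h6 := ih (by omega)
    simp only [Balanced] at h4
    simp only [Nat.succ_eq_add_one] at *
    omega

/-- Matched brackets nest. Balance at the common `k` gives `i` and `j` the same difference of rank
and `r`, so distinct nodes have distinct `r`. If `i` comes first, the surplus of right endpoints at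
`r j` given by `IsNext.sub_lt` contradicts that equality. -/
theorem IsNext.left_unique (hr : ∀ i, i ≤ r i) (hN : N ≤ M) (h : IsNext M N r i k)
    (h' : IsNext M N r j k) : i = j := by
  wlog hij : rightRank M r i ≤ rightRank M r j generalizing i j
  · exact (this h' h (le_of_not_ge hij)).symm
  have hk := h.1.2.1
  have hi : i < M := by have := h.lt hr; omega
  have hj : j < M := by have := h'.lt hr; omega
  have h1 := h.1.2.2
  have h2 := h'.1.2.2
  have h3 := (rightRank_lt_iff (r := r) hj hi).not.1 (by omega)
  by_contra hne
  have hlt : r i < r j := by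
    have h4 := (rightRank_lt_iff (r := r) hi hj).2 (by omega)
    by_contra
    have : r i = r j := by omega
    omega
  have h4 := h.sub_lt hi hlt h'.1.1
  have h5 := (rightRank_lt_numEnded_iff (r := r) (j := r j) hj).not.2 (lt_irrefl _)
  omega

/-- At the first node of a color class, more intervals overlap than at any node before. -/
theorem IsFirst.sub_lt (h : IsFirst M N r j) (hj : j < N) (hij : i < j) :
    i + numEnded M r j < j + numEnded M r i := by
  by_contra hle
  -- The last `k` before `j` whose overlap is at least that at `j`; the overlap drops at `k + 1`, so
  -- a right endpoint following left endpoint `k` matches `j`.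
  obtain ⟨k, hk⟩ : ∃ k, k = Nat.findGreatest
    (fun k => k < j ∧ j + numEnded M r k ≤ k + numEnded M r j) j := ⟨_, rfl⟩
  have hk1 : k < j ∧ j + numEnded M r k ≤ k + numEnded M r j := by
    rw [hk]
    exact Nat.findGreatest_spec (P := fun k => k < j ∧ j + numEnded M r k ≤ k + numEnded M r j)
      hij.le ⟨hij, by omega⟩
  have hk2 : ∀ m, k < m → m < j → m + numEnded M r j < j + numEnded M r m := by
    intro m hm hmj
    have := Nat.findGreatest_is_greatest (hk ▸ hm) hmj.le
    omega
  clear hk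
  have hk3 : k + 1 + numEnded M r j ≤ j + numEnded M r (k + 1) := by
    rcases (show k + 1 ≤ j from hk1.1).eq_or_lt with h1 | h1
    · rw [h1]
    · exact (hk2 _ k.lt_succ_self h1).le
  have hle := numEnded_le (M := M) (r := r) (j := k + 1)
  -- This rank is forced by balance between `i'` and `j` with `r i' = k`. It lies in `[numEnded k,
  -- numEnded (k + 1))`, which is what `r i' = k` means.
  obtain ⟨i', hi', ht⟩ := exists_rightRank_eq (M := M) (r := r)
    (t := k + numEnded M r j - j) (by omega)
  have h1 := (rightRank_lt_numEnded_iff (r := r) (j := k + 1) hi').1 (by omega)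
  have h2 := (rightRank_lt_numEnded_iff (r := r) (j := k) hi').not.1 (by omega)
  have h3 : r i' = k := by omega
  refine h i' ⟨⟨by omega, hj, by omega⟩, ?_⟩
  rintro m hm ⟨hm1, -, hm2⟩
  have := hk2 m (by omega) hm
  omega

end Classes

/-! ### Chains of matched nodes and their first elements -/

section Classes

variable {M N : ℕ} {r : ℕ → ℕ} {i j k : ℕ}

theorem IsFirst.eq_of_reflTransGen (hk : IsFirst M N r k)
    (h : Relation.ReflTransGen (IsNext M N r) j k) : j = k := by
  rcases h.cases_tail with h | ⟨m, -, h⟩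
  · exact h.symm
  · exact absurd h (hk m)

theorem le_of_reflTransGen_isNext (hr : ∀ i, i ≤ r i)
    (h : Relation.ReflTransGen (IsNext M N r) i j) : i ≤ j := by
  induction h with
  | refl => exact le_rfl
  | tail _ h ih => exact ih.trans (h.lt hr).le

/-- The right-hand side is the minimality test that the program performs. -/
theorem isFirst_iff_of_lt (hr : ∀ i, i ≤ r i) :
    IsFirst M N r i ↔ ∀ k, Relation.ReflTransGen (IsNext M N r) k i → i ≤ k := by
  refine ⟨fun h k hk => (h.eq_of_reflTransGen hk).ge, fun h k hk => ?_⟩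
  exact (hk.lt hr).not_ge (h k (.single hk))

theorem exists_isFirst (hr : ∀ i, i ≤ r i) (i : ℕ) :
    ∃ k, IsFirst M N r k ∧ Relation.ReflTransGen (IsNext M N r) k i := by
  induction i using Nat.strong_induction_on with
  | _ i ih =>
    by_cases h : IsFirst M N r i
    · exact ⟨i, h, .refl⟩
    · simp only [IsFirst, not_forall, not_not] at h
      obtain ⟨m, hm⟩ := h
      obtain ⟨k, hk, hkm⟩ := ih m (hm.lt hr)
      exact ⟨k, hk, hkm.tail hm⟩

/-- Predecessors are unique, so two chains ending in `i` are nested, and a first node has nothing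
before it. -/
theorem IsFirst.unique (hr : ∀ i, i ≤ r i) (hN : N ≤ M) (hj : IsFirst M N r j)
    (hk : IsFirst M N r k) (hji : Relation.ReflTransGen (IsNext M N r) j i)
    (hki : Relation.ReflTransGen (IsNext M N r) k i) : j = k := by
  have hu : Relator.RightUnique (Function.swap (IsNext M N r)) :=
    fun _ _ _ h h' => IsNext.left_unique hr hN h h'
  rcases Relation.ReflTransGen.total_of_right_unique hu (Relation.reflTransGen_swap.2 hji)
    (Relation.reflTransGen_swap.2 hki) with h | h
  · exact (hj.eq_of_reflTransGen (Relation.reflTransGen_swap.1 h)).symm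
  · exact hk.eq_of_reflTransGen (Relation.reflTransGen_swap.1 h)

end Classes

open Classical in
/-- The rank of the color class of `i`, where color classes are ordered by their first nodes. -/
noncomputable def colorRank (M N : ℕ) (r : ℕ → ℕ) (hr : ∀ i, i ≤ r i) (i : ℕ) : ℕ :=
  Nat.count (IsFirst M N r) (exists_isFirst (M := M) (N := N) hr i).choose

/-! ### Properness of the coloring and the overlap bound -/

section ColorRank

variable {M N : ℕ} {r : ℕ → ℕ} {hr : ∀ i, i ≤ r i} {i j k : ℕ}

open Classical in
theorem colorRank_eq_count (hN : N ≤ M) (hk : IsFirst M N r k)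
    (hki : Relation.ReflTransGen (IsNext M N r) k i) :
    colorRank M N r hr i = Nat.count (IsFirst M N r) k := by
  have h := (exists_isFirst (M := M) (N := N) hr i).choose_spec
  rw [colorRank, h.1.unique hr hN hk h.2 hki]

open Classical in
theorem exists_colorRank_eq (hN : N ≤ M) (h : j < colorRank M N r hr i) :
    ∃ k ≤ i, colorRank M N r hr k = j := by
  obtain ⟨f, hf, hfi⟩ := exists_isFirst (M := M) (N := N) hr i
  rw [colorRank_eq_count hN hf hfi] at h
  have hlt := Nat.nth_lt_of_lt_count h
  -- `Nat.nth` has a default value beyond the end of a finite set; this bound excludes that case.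
  have hcard (hfin : (Set.ofPred (IsFirst M N r)).Finite) : j < hfin.toFinset.card :=
    h.trans_le (Nat.count_le_card hfin f)
  refine ⟨_, hlt.le.trans (le_of_reflTransGen_isNext hr hfi), ?_⟩
  rw [colorRank_eq_count hN (Nat.nth_mem j hcard) .refl, Nat.count_nth hcard]

theorem colorRank_lt_iff (hN : N ≤ M) {j' k' : ℕ} (hj' : IsFirst M N r j')
    (hk' : IsFirst M N r k') (hj : Relation.ReflTransGen (IsNext M N r) j' j)
    (hk : Relation.ReflTransGen (IsNext M N r) k' k) :
    colorRank M N r hr j < colorRank M N r hr k ↔ j' < k' := by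
  classical
  rw [colorRank_eq_count hN hj' hj, colorRank_eq_count hN hk' hk]
  refine ⟨fun h => ?_, fun h => Nat.count_strict_mono hj' h⟩
  by_contra hn
  exact h.not_ge (Nat.count_monotone _ (not_lt.1 hn))

/-- Nodes with the same color are not adjacent. -/
theorem lt_of_colorRank_eq (hN : N ≤ M) (hij : i < j)
    (h : colorRank M N r hr i = colorRank M N r hr j) : r i < j := by
  obtain ⟨f, hf, hfi⟩ := exists_isFirst (M := M) (N := N) hr i
  obtain ⟨g, hg, hgj⟩ := exists_isFirst (M := M) (N := N) hr j
  have h1 := (colorRank_lt_iff (hr := hr) hN hf hg hfi hgj).not.1 h.not_lt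
  have h2 := (colorRank_lt_iff (hr := hr) hN hg hf hgj hfi).not.1 h.not_gt
  obtain rfl : f = g := by omega
  have hu : Relator.RightUnique (IsNext M N r) := fun _ _ _ h h' => IsNext.right_unique h h'
  -- Both nodes lie on the chain from one first node, so `j` is reached through the successor of
  -- `i`, which begins after `i` has ended.
  rcases Relation.ReflTransGen.total_of_right_unique hu hfi hgj with h | h
  · rcases h.cases_head with h | ⟨m, hm, hmj⟩
    · exact absurd h hij.ne
    · exact hm.1.1.trans_le (le_of_reflTransGen_isNext hr hmj)
  · exact absurd (le_of_reflTransGen_isNext hr h) hij.not_ge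

-- The overlap is strictly increasing along first nodes, so it maps those before `j` injectively
-- into the numbers below the overlap at `j`.
open Classical in
theorem count_isFirst_le (hr : ∀ i, i ≤ r i) (hN : N ≤ M) (h : IsFirst M N r j) (hj : j < N) :
    Nat.count (IsFirst M N r) j ≤ ((Finset.range j).filter fun k => j ≤ r k).card := by
  have hadd {k : ℕ} (hk : k < N) := numEnded_add_card (M := M) hr (hk.le.trans hN)
  rw [Nat.count_eq_card_filter_range]
  conv_rhs => rw [← Finset.card_range (Finset.card _)]
  refine Finset.card_le_card_of_injOn
    (fun i => ((Finset.range i).filter fun k => i ≤ r k).card) ?_ ?_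
  · intro i hi
    simp only [Finset.coe_filter, Finset.mem_range, Set.mem_ofPred_eq] at hi
    have h1 := h.sub_lt hj hi.1
    have h2 := hadd hj
    have h3 := hadd (hi.1.trans hj)
    simp only [Finset.coe_range, Set.mem_Iio]
    omega
  · intro i hi k hk hik
    simp only [Finset.coe_filter, Finset.mem_range, Set.mem_ofPred_eq] at hi hk hik
    have h2 := hadd (hi.1.trans hj)
    have h3 := hadd (hk.1.trans hj)
    rcases lt_trichotomy i k with hlt | hlt | hlt
    · have := hk.2.sub_lt (hk.1.trans hj) hlt
      omega
    · exact hlt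
    · have := hi.2.sub_lt (hi.1.trans hj) hlt
      omega

end ColorRank

/-! ### Correctness of the program -/

section Program

variable {n N : ℕ} {E : ℕ → ℕ → Prop} {r : ℕ → ℕ}

theorem IsLastNeighbor.le_and_adj_iff (h : IsLastNeighbor N E r) (i j : ℕ) :
    i ≤ j ∧ (E i j ∨ i = j) ↔ i ≤ j ∧ j ≤ r i := by
  have h1 := h.le_self i
  rw [h.adj_iff]
  constructor
  · rintro ⟨h2, h3⟩
    refine ⟨h2, ?_⟩
    omega
  · rintro ⟨h2, h3⟩
    refine ⟨h2, ?_⟩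
    rcases lt_or_ge i N with hi | hi
    · have := h.lt_of_lt hi
      omega
    · have := h.eq_of_le hi
      omega

/-- Disjoint intervals: one ends before the other begins. This form already excludes `i = j`. -/
theorem IsLastNeighbor.compl_iff (h : IsLastNeighbor N E r) {i j : ℕ} :
    (i < N ∧ j < N ∧ ¬ E i j ∧ i ≠ j) ↔ i < N ∧ j < N ∧ (r i < j ∨ r j < i) := by
  have h1 := h.le_self i
  have h2 := h.le_self j
  rw [h.adj_iff]
  omega

theorem IsLastNeighbor.lt_of_mem (h : IsLastNeighbor N E r) {M i : ℕ} (hN : N ≤ M) (hi : i < M) :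
    r i < M := by
  rcases lt_or_ge i N with hi' | hi'
  · exact (h.lt_of_lt hi').trans_le hN
  · rwa [h.eq_of_le hi']

theorem IsLastNeighbor.adj_or_eq_iff (h : IsLastNeighbor N E r) {i j : ℕ} (hij : i ≤ j) :
    E i j ∨ i = j ↔ j ≤ r i := by
  simpa [hij] using h.le_and_adj_iff i j

/-- The last neighbors of nodes `i` and `j` are compared by comparing maximal neighbors. -/
theorem IsLastNeighbor.rightRank_lt_iff (h : IsLastNeighbor N E r) {M i j : ℕ} (hN : N ≤ M)
    (hi : i < M) (hj : j < M) :
    (∃ i1 : Fin M, i ≤ i1 ∧ ∃ j1 : Fin M, j ≤ j1 ∧ (E i i1 ∨ i = i1) ∧ (E j j1 ∨ j = j1) ∧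
      (i1 < j1 ∨ (i1 : ℕ) = j1 ∧ i < j) ∧ ∀ i2 : Fin M, i ≤ i2 → ∀ j2 : Fin M, j ≤ j2 →
        E i i2 ∨ i = i2 → E j j2 ∨ j = j2 → i2 ≤ i1 ∧ j2 ≤ j1) ↔
      rightRank M r i < rightRank M r j := by
  rw [ImplicitColoring.rightRank_lt_iff hi hj]
  have hri := h.lt_of_mem hN hi
  have hrj := h.lt_of_mem hN hj
  have hEi := (h.adj_or_eq_iff (h.le_self i)).2 le_rfl
  have hEj := (h.adj_or_eq_iff (h.le_self j)).2 le_rfl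
  constructor
  · rintro ⟨i1, hi1, j1, hj1, hi2, hj2, hlt, hmax⟩
    rw [h.adj_or_eq_iff hi1] at hi2
    rw [h.adj_or_eq_iff hj1] at hj2
    -- Testing maximality against the pair of last neighbors forces `i1 = r i` and `j1 = r j`.
    have := hmax ⟨r i, hri⟩ (h.le_self i) ⟨r j, hrj⟩ (h.le_self j) hEi hEj
    simp only [Fin.le_def, Fin.lt_def] at this hlt
    omega
  · intro hlt
    refine ⟨⟨r i, hri⟩, h.le_self i, ⟨r j, hrj⟩, h.le_self j, hEi, hEj, hlt, ?_⟩
    intro i2 hi2 j2 hj2 hi3 hj3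
    exact ⟨(h.adj_or_eq_iff hi2).1 hi3, (h.adj_or_eq_iff hj2).1 hj3⟩

/-- The nodes whose right endpoints lie between the right endpoint of `i` and the left endpoint
of `j`. -/
theorem IsLastNeighbor.ended_between_iff (h : IsLastNeighbor N E r) {M i j k : ℕ}
    (hj : j < M) (hk : k < M) :
    rightRank M r i ≤ rightRank M r k ∧ rightRank M r k < rightRank M r j ∧
      (k < N ∧ j < N ∧ (r k < j ∨ r j < k)) ↔
    j < N ∧ rightRank M r i ≤ rightRank M r k ∧ r k < j := by
  rw [ImplicitColoring.rightRank_lt_iff hk hj]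
  have h1 := h.le_self k
  have h2 := h.le_self j
  omega

/-- The number of right endpoints from that of `i` up to the left endpoint of `j`, by the last
of these right endpoints. -/
theorem exists_last_ended_iff (hr : ∀ i, i ≤ r i) {M i j l : ℕ} (hi : i < M) :
    (i < j ∧ ∃ k : Fin M, j < N ∧ rightRank M r i ≤ rightRank M r k ∧ r k < j ∧
      rightRank M r k = rightRank M r i + l ∧
      ∀ k' : Fin M, j < N → rightRank M r i ≤ rightRank M r k' → r k' < j →
        rightRank M r k' ≤ rightRank M r k) ↔
    j < N ∧ r i < j ∧ rightRank M r i + l + 1 = numEnded M r j := by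
  constructor
  · rintro ⟨hij, k, hj, hik, hkj, hl, hmax⟩
    have h1 := (rightRank_lt_numEnded_iff k.2).2 hkj
    have h2 := numEnded_le (M := M) (r := r) (j := j)
    refine ⟨hj, (rightRank_lt_numEnded_iff hi).1 (by omega), ?_⟩
    -- Ended nodes occupy the ranks below `numEnded M r j`, so the last of them has this rank.
    obtain ⟨k', hk', ht⟩ := exists_rightRank_eq (M := M) (r := r)
      (t := numEnded M r j - 1) (by omega)
    have := hmax ⟨k', hk'⟩ hj (by simp only; omega)
      ((rightRank_lt_numEnded_iff hk').1 (by omega))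
    simp only at this
    omega
  · rintro ⟨hj, hij, hl⟩
    have h2 := numEnded_le (M := M) (r := r) (j := j)
    obtain ⟨k, hk, ht⟩ := exists_rightRank_eq (M := M) (r := r)
      (t := numEnded M r j - 1) (by omega)
    refine ⟨(hr i).trans_lt hij, ⟨k, hk⟩, hj, by simp only; omega,
      (rightRank_lt_numEnded_iff hk).1 (by omega), by simp only; omega, ?_⟩
    intro k' _ _ hk'
    have := (rightRank_lt_numEnded_iff k'.2).2 hk'
    simp only
    omega

/-- The number of left endpoints after the right endpoint of `i` and up to `j`, by the first of
these left endpoints. -/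
theorem exists_first_begun_iff (hr : ∀ i, i ≤ r i) {M i j l : ℕ} (hN : N ≤ M) :
    (i ≤ j ∧ ∃ k : Fin M, i < k ∧ k ≤ j ∧ i < N ∧ k < N ∧ r i < k ∧ j = k + l ∧
      ∀ k' : Fin M, i < k' → k' ≤ j → i < N → k' < N → r i < k' → k ≤ k') ↔
    r i + 1 < N ∧ r i + 1 + l = j := by
  have hi := hr i
  constructor
  · rintro ⟨hij, k, h1, h2, h3, h4, h5, h6, hmin⟩
    -- The first node to begin after `i` has ended is `r i + 1`.
    have := hmin ⟨r i + 1, by omega⟩ (by simp only; omega) (by simp only; omega) h3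
      (by simp only; omega) (by simp only; omega)
    simp only [Fin.le_def] at this
    omega
  · rintro ⟨h1, rfl⟩
    refine ⟨by omega, ⟨r i + 1, by omega⟩, by simp only; omega, by simp only; omega, by omega,
      by simp only; omega, by simp only; omega, by simp only, ?_⟩
    intro k' _ _ _ _ h
    exact Fin.le_def.2 h

end Program

theorem coloringAlgorithm_spec {n N : ℕ} {E : ℕ → ℕ → Prop} {r : ℕ → ℕ}
    (h : IsLastNeighbor N E r) (hN : N ≤ 2 ^ n) (env : Env n)
    (hV : ∀ σ, env chiV σ = true ↔ bval (σ x) < N)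
    (hE : ∀ σ, env chiE σ = true ↔ E (bval (σ x)) (bval (σ y))) (σ : Assign n) :
    Prog.run (coloringAlgorithm n) env color σ = true ↔
      colorRank (2 ^ n) N r h.le_self (bval (σ x)) = bval (σ l) := by
  have hr := h.le_self
  simp only [coloringAlgorithm, run_append]
  set env1 := Prog.run [_, _, _] env with h1
  have hEO1 : ∀ σ, env1 EO σ = true ↔
      rightRank (2 ^ n) r (bval (σ x)) < rightRank (2 ^ n) r (bval (σ y)) := by
    intro σ
    rw [← h.rightRank_lt_iff hN (bval_lt _) (bval_lt _), h1]
    simp [run_cons, run_nil, hE, argPerm, Equiv.swap_apply_def, Function.update_apply, and_assoc]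
  have hcompl1 : ∀ σ, env1 compl σ = true ↔ bval (σ x) < N ∧ bval (σ y) < N ∧
        (r (bval (σ x)) < bval (σ y) ∨ r (bval (σ y)) < bval (σ x)) := by
    intro σ
    rw [← h.compl_iff, h1]
    simp [run_cons, run_nil, hV, hE, argPerm, Equiv.swap_apply_def, and_assoc]
  clear_value env1
  set env2 := Prog.run (enumerateOrder n EO EEO) env1 with h2
  have hEO2 : ∀ σ, env2 EO σ = true ↔
      rightRank (2 ^ n) r (bval (σ x)) < rightRank (2 ^ n) r (bval (σ y)) := by
    intro σ
    rw [h2, enumerateOrder_frame (by decide) (by decide) (by decide), hEO1]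
  have hcompl2 : ∀ σ, env2 compl σ = true ↔ bval (σ x) < N ∧ bval (σ y) < N ∧
        (r (bval (σ x)) < bval (σ y) ∨ r (bval (σ y)) < bval (σ x)) := by
    intro σ
    rw [h2, enumerateOrder_frame (by decide) (by decide) (by decide), hcompl1]
  have hEEO2 : ∀ σ, env2 EEO σ = true ↔ rightRank (2 ^ n) r (bval (σ x)) = bval (σ l) :=
    enumerateOrder_spec (by decide) (by decide) env1 _ hEO1 fun k hk j hj =>
      exists_rightRank_eq (hj.trans (rightRank_lt hk))
  clear_value env2
  set env3 := Prog.run [_, _, _, _, _] env2 with h3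
  have hrelated : ∀ σ, env3 related σ = true ↔
      IsNext (2 ^ n) N r (bval (σ x)) (bval (σ y)) := by
    intro σ
    rw [h3, run_cons]
    set env4 := Function.update env2 H1 _ with h4
    have hEO4 : env4 EO = env2 EO := Function.update_of_ne (by decide) _ _
    have hEEO4 : env4 EEO = env2 EEO := Function.update_of_ne (by decide) _ _
    have hcompl4 : env4 compl = env2 compl := Function.update_of_ne (by decide) _ _
    have hH1 : ∀ σ, env4 H1 σ = true ↔ bval (σ y) < N ∧ rightRank (2 ^ n) r (bval (σ x)) ≤
        rightRank (2 ^ n) r (bval (σ z)) ∧ r (bval (σ z)) < bval (σ y) := by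
      intro σ
      rw [← h.ended_between_iff (bval_lt _) (bval_lt _), h4]
      simp [hEO2, hcompl2, argPerm, Equiv.swap_apply_def, and_assoc]
    clear_value env4
    rw [run_cons]
    set env5 := Function.update env4 H2 _ with h5
    have hEO5 : env5 EO = env2 EO := by rw [h5, Function.update_of_ne (by decide), hEO4]
    have hEEO5 : env5 EEO = env2 EEO := by rw [h5, Function.update_of_ne (by decide), hEEO4]
    have hH1' : env5 H1 = env4 H1 := Function.update_of_ne (by decide) _ _
    have hH2 : ∀ σ, env5 H2 σ = true ↔ bval (σ x) < bval (σ z) ∧ bval (σ z) ≤ bval (σ y) ∧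
        bval (σ x) < N ∧ bval (σ z) < N ∧ r (bval (σ x)) < bval (σ z) := by
      intro σ
      have hx := hr (bval (σ x))
      have hz := hr (bval (σ z))
      rw [h5]
      simp [hcompl4, hcompl2, argPerm, Equiv.swap_apply_def]
      omega
    clear_value env5
    rw [run_cons]
    set env6 := Function.update env5 RE _ with h6
    have hH2' : env6 H2 = env5 H2 := Function.update_of_ne (by decide) _ _
    have hRE : ∀ σ, env6 RE σ = true ↔ bval (σ y) < N ∧ r (bval (σ x)) < bval (σ y) ∧
        rightRank (2 ^ n) r (bval (σ x)) + bval (σ l) + 1 =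
          numEnded (2 ^ n) r (bval (σ y)) := by
      intro σ
      rw [← exists_last_ended_iff hr (bval_lt _), h6]
      simp [hH1', hH1, hEEO5, hEEO2, hEO5, hEO2, argPerm, Equiv.swap_apply_def,
        Function.update_apply, and_assoc]
      intro _ hy
      constructor
      · rintro ⟨k, hk1, hk2, k1, hl1, k2, hl2, hl, hmax⟩
        exact ⟨k, hk1, hk2, by omega, fun k' _ => hmax hy k'⟩
      -- The witnesses for `l1` and `l2` are the ranks of `x` and `z`; being below `2 ^ n`, they fit
      -- into `n` bits.
      · rintro ⟨k, hk1, hk2, hl, hmax⟩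
        exact ⟨k, hk1, hk2, ⟨_, rightRank_lt (bval_lt (σ x))⟩, rfl, ⟨_, rightRank_lt k.2⟩, rfl, hl,
          fun _ k' => hmax k' hy⟩
    clear_value env6
    rw [run_cons]
    set env7 := Function.update env6 LE _ with h7
    have hRE' : env7 RE = env6 RE := Function.update_of_ne (by decide) _ _
    have hLE : ∀ σ, env7 LE σ = true ↔ r (bval (σ x)) + 1 < N ∧
        r (bval (σ x)) + 1 + bval (σ l) = bval (σ y) := by
      intro σ
      rw [← exists_first_begun_iff hr hN, h7]
      simp [hH2', hH2, argPerm, Equiv.swap_apply_def, Function.update_apply, and_assoc]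
    clear_value env7
    rw [run_cons, run_nil]
    simp [hRE', hRE, hLE, argPerm, Equiv.swap_apply_def, Function.update_apply, and_assoc]
    -- `RE` and `LE` both store their count minus one, so a common value of `l` amounts to
    -- `Balanced`; that value is `y - (r x + 1)`.
    constructor
    · rintro ⟨hy, hxy, k, hk1, hk2, hk3, hmin⟩
      refine ⟨⟨hxy, hy, by omega⟩, ?_⟩
      rintro m hm ⟨hm1, hm2, hm3⟩
      exact hmin ⟨m, by omega⟩ hm hm2 hm1 ⟨m - (r (bval (σ x)) + 1), by omega⟩
        (by simp only; omega) hk2 (by simp only; omega)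
    · rintro ⟨⟨hxy, hy, heq⟩, hmin⟩
      refine ⟨hy, hxy, ⟨bval (σ y) - (r (bval (σ x)) + 1), by omega⟩, by simp only; omega,
        by omega, by simp only; omega, ?_⟩
      intro m hm hm2 hm1 k hk1 _ hk2
      exact hmin m hm ⟨hm1, hm2, by omega⟩
  clear_value env3
  set env4 := Prog.run (transitiveClosure n _ sameColor) env3 with h4
  have hsame : ∀ σ, env4 sameColor σ = true ↔
      Relation.ReflTransGen (IsNext (2 ^ n) N r) (bval (σ x)) (bval (σ y)) := by
    intro σ
    -- The program closes the relation already made reflexive, as the spec requires.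
    rw [← Relation.reflTransGen_reflGen]
    refine transitiveClosure_spec env3 _ (fun _ => .refl) ?_ ?_ σ
    · rintro i j (_ | hij)
      exacts [le_rfl, (hij.lt hr).le]
    · intro σ
      rw [eval_or, eval_reg, hrelated, eval_eq _ _ (by decide), Relation.reflGen_iff, or_comm,
        eq_comm]
  clear_value env4
  set env5 := Prog.run [_, _] env4 with h5
  have horder : ∀ σ, env5 colorOrder σ = true ↔
      colorRank (2 ^ n) N r hr (bval (σ x)) < colorRank (2 ^ n) N r hr (bval (σ y)) := by
    intro σ
    rw [h5, run_cons]
    set env6 := Function.update env4 first _ with h6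
    have hsame' : env6 sameColor = env4 sameColor := Function.update_of_ne (by decide) _ _
    have hfirst : ∀ σ, env6 first σ = true ↔ IsFirst (2 ^ n) N r (bval (σ x)) := by
      intro σ
      rw [isFirst_iff_of_lt hr, h6]
      simp [hsame, argPerm, Equiv.swap_apply_def, Function.update_apply]
      refine ⟨fun hf k hk => ?_, fun hf k hk => hf k hk⟩
      have hle := le_of_reflTransGen_isNext hr hk
      exact hf ⟨k, hle.trans_lt (bval_lt _)⟩ hk
    clear_value env6
    rw [run_cons, run_nil]
    simp [hsame', hsame, hfirst, argPerm, Equiv.swap_apply_def, Function.update_apply, and_assoc]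
    constructor
    · rintro ⟨j, hj, hj', k, hk, hk', hjk⟩
      exact (colorRank_lt_iff hN hj' hk' hj hk).2 hjk
    · intro hlt
      obtain ⟨j, hj', hj⟩ := exists_isFirst (M := 2 ^ n) (N := N) hr (bval (σ x))
      obtain ⟨k, hk', hk⟩ := exists_isFirst (M := 2 ^ n) (N := N) hr (bval (σ y))
      exact ⟨⟨j, (le_of_reflTransGen_isNext hr hj).trans_lt (bval_lt _)⟩, hj, hj',
        ⟨k, (le_of_reflTransGen_isNext hr hk).trans_lt (bval_lt _)⟩, hk, hk',
        (colorRank_lt_iff hN hj' hk' hj hk).1 hlt⟩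
  clear_value env5
  refine enumerateOrder_spec (by decide) (by decide) env5 _ horder (fun k hk j hj => ?_) σ
  -- Every smaller color occurs at a number not exceeding `k`, hence within `n` bits.
  obtain ⟨i, hi, hij⟩ := exists_colorRank_eq hN hj
  exact ⟨i, hi.trans_lt hk, hij⟩

/-! ### The number of operations -/

section Cost

variable {n : ℕ}

@[simp] theorem cost_reg (r : Reg) : (Expr.reg r : Expr n).cost = 0 := rfl

@[simp] theorem cost_neg (e : Expr n) : e.neg.cost = e.cost + 1 := rfl

@[simp] theorem cost_and (e f : Expr n) : (e.and f).cost = e.cost + f.cost + 1 := rfl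

@[simp] theorem cost_or (e f : Expr n) : (e.or f).cost = e.cost + f.cost + 1 := rfl

@[simp] theorem cost_ex (v : Vec) (e : Expr n) : (Expr.ex v e).cost = e.cost + n := by
  have (L : List (Fin n)) :
      (L.foldr (fun i f => Expr.exBit v i f) e).cost = e.cost + L.length := by
    induction L with
    | nil => rfl
    | cons i L ih => simp [Expr.cost, ih, add_assoc]
  simp [Expr.ex, this]

@[simp] theorem cost_subst (v : Vec) (c : ℕ) (e : Expr n) :
    (Expr.subst v c e).cost = e.cost + n := by
  have (L : List (Fin n)) :
      (L.foldr (fun i f => Expr.restrict v i (bits n c i) f) e).cost = e.cost + L.length := by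
    induction L with
    | nil => rfl
    | cons i L ih => simp [Expr.cost, ih, add_assoc]
  simp [Expr.subst, this]

-- The factor is 3 (11 - 1), for the eleven vectors in `Vec`.
@[simp] theorem cost_call (r : Reg) (s : List (Vec × Vec)) :
    (call r s : Expr n).cost = 30 * n := by
  simp [call, Expr.cost, show Fintype.card Vec = 11 from rfl]

@[simp] theorem cost_geq (p q : List Vec) (T : ℤ) : (geq p q T : Expr n).cost = 1 := rfl

@[simp] theorem cost_eqn (p q : List Vec) (T : ℤ) : (eqn p q T : Expr n).cost = 3 := rfl

@[simp] theorem cost_le (u v : Vec) : (le u v : Expr n).cost = 1 := rfl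

@[simp] theorem cost_lt (u v : Vec) : (lt u v : Expr n).cost = 1 := rfl

@[simp] theorem cost_eq (u v : Vec) : (eq u v : Expr n).cost = 3 := rfl

@[simp] theorem cost_nil : Prog.cost ([] : Prog n) = 0 := rfl

@[simp] theorem cost_cons (s : Stmt n) (p : Prog n) :
    Prog.cost (s :: p) = s.value.cost + Prog.cost p := by
  simp [Prog.cost]

@[simp] theorem cost_append (p q : Prog n) :
    Prog.cost (p ++ q) = Prog.cost p + Prog.cost q := by
  simp [Prog.cost]

theorem cost_map_range (f : ℕ → Stmt n) (k c : ℕ) (h : ∀ j, (f j).value.cost = c) :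
    Prog.cost ((List.range k).map f) = k * c := by
  simp [Prog.cost, Function.comp_def, h]

theorem cost_enumerateOrder (O out : Reg) :
    (enumerateOrder n O out).cost = n * (63 * n + 12) + 123 * n + 17 := by
  simp only [enumerateOrder, cost_append]
  rw [cost_map_range _ _ (63 * n + 12) fun j => by simp; omega]
  simp
  ring

theorem cost_transitiveClosure (R : Expr n) (out : Reg) :
    (transitiveClosure n R out).cost = R.cost + (n + 1) * (61 * n + 1) := by
  simp only [transitiveClosure, cost_cons]
  rw [cost_map_range _ _ (61 * n + 1) fun j => by simp; ring]

theorem cost_coloringAlgorithm_le : (coloringAlgorithm n).cost ≤ 2000 * (n + 1) ^ 2 := by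
  simp only [coloringAlgorithm, cost_append, cost_enumerateOrder, cost_transitiveClosure]
  simp
  ring_nf
  nlinarith

end Cost

theorem cost_isBigO :
    (fun N : ℕ => ((coloringAlgorithm (Nat.clog 2 N)).cost : ℝ))
      =O[Filter.atTop] (fun N : ℕ => Real.log N ^ 2) := by
  -- With n = ⌈log₂ N⌉ and log 2 > 1/2, both n - 1 ≤ 2 log N and 2 ≤ 4 log N hold, so n + 1 ≤ 6 log
  -- N; squaring gives 36.
  refine Asymptotics.IsBigO.of_bound (2000 * 36) ?_
  filter_upwards [Filter.eventually_ge_atTop 2] with N hN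
  have hlog2 : (1 / 2 : ℝ) < Real.log 2 := by linarith [Real.log_two_gt_d9]
  have hN' : (2 : ℝ) ≤ N := by exact_mod_cast hN
  have hlogN : Real.log 2 ≤ Real.log N := Real.log_le_log two_pos hN'
  have hpow : 2 ^ (Nat.clog 2 N - 1) < N := Nat.pow_pred_clog_lt_self one_lt_two hN
  have hpos : 0 < Nat.clog 2 N := Nat.clog_pos one_lt_two hN
  have h1 : ((Nat.clog 2 N - 1 : ℕ) : ℝ) * Real.log 2 ≤ Real.log N := by
    rw [← Real.log_pow]
    exact Real.log_le_log (by positivity) (by exact_mod_cast hpow.le)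
  rw [Nat.cast_sub hpos, Nat.cast_one] at h1
  have h2 : (Nat.clog 2 N : ℝ) + 1 ≤ 6 * Real.log N := by
    have : (0 : ℝ) ≤ (Nat.clog 2 N : ℝ) - 1 := by
      rw [sub_nonneg]
      exact_mod_cast hpos
    nlinarith
  rw [Real.norm_of_nonneg (by positivity), Real.norm_of_nonneg (by positivity)]
  calc ((coloringAlgorithm (Nat.clog 2 N)).cost : ℝ)
      ≤ 2000 * ((Nat.clog 2 N : ℝ) + 1) ^ 2 := by exact_mod_cast cost_coloringAlgorithm_le
    _ ≤ 2000 * (6 * Real.log N) ^ 2 := by gcongr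
    _ = 2000 * 36 * Real.log N ^ 2 := by ring

/-! ### Interval graphs -/

/-- The adjacency relation of a graph on `Fin N`, on natural numbers. -/
def natAdj {N : ℕ} (G : SimpleGraph (Fin N)) (u v : ℕ) : Prop :=
  ∃ i j : Fin N, u = i ∧ v = j ∧ G.Adj i j

theorem intervalGraph_adj_of_lt {N : ℕ} {a b : Fin N → ℝ} (hab : ∀ i, a i < b i)
    (ha : Monotone a) {i j : Fin N} (hij : i < j) :
    (intervalGraph a b).Adj i j ↔ a j ≤ b i := by
  have h1 := ha hij.le
  constructor
  · rintro ⟨-, t, ht⟩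
    exact ht.2.1.trans ht.1.2
  · exact fun h => ⟨hij.ne, a j, ⟨h1, h⟩, le_rfl, (hab j).le⟩

/-- By monotonicity of `a`, the `v` with `a v ≤ b u` form an initial segment; `r u` is its last
element. -/
theorem exists_isLastNeighbor {N : ℕ} {a b : Fin N → ℝ} (hab : ∀ i, a i < b i)
    (ha : Monotone a) : ∃ r, IsLastNeighbor N (natAdj (intervalGraph a b)) r := by
  classical
  let P : ℕ → ℕ → Prop := fun u v => ∃ (hu : u < N) (hv : v < N), a ⟨v, hv⟩ ≤ b ⟨u, hu⟩
  have hself {u : ℕ} (hu : u < N) : P u u := ⟨hu, hu, (hab _).le⟩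
  let r : ℕ → ℕ := fun u => if u < N then Nat.findGreatest (P u) (N - 1) else u
  have hr {u : ℕ} (hu : u < N) : r u = Nat.findGreatest (P u) (N - 1) := if_pos hu
  have hspec {u : ℕ} (hu : u < N) : P u (r u) := by
    rw [hr hu]
    exact Nat.findGreatest_spec (by omega) (hself hu)
  have hle {u v : ℕ} (h : P u v) : v ≤ r u := by
    obtain ⟨hu, hv, -⟩ := id h
    rw [hr hu]
    exact Nat.le_findGreatest (by omega) h
  have hadj {i j : Fin N} (hij : i < j) :
      (intervalGraph a b).Adj i j ↔ (j : ℕ) ≤ r i := by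
    rw [intervalGraph_adj_of_lt hab ha hij]
    refine ⟨fun h => hle ⟨i.2, j.2, h⟩, fun h => ?_⟩
    obtain ⟨_, h1, h2⟩ := hspec i.2
    exact (ha (show j ≤ ⟨r i, h1⟩ from h)).trans h2
  refine ⟨r, fun u => ?_, fun hu => (hspec hu).2.1, fun hu => if_neg hu.not_gt, fun u v => ?_⟩
  · by_cases hu : u < N
    · exact hle (hself hu)
    · exact (if_neg hu).ge
  · constructor
    · rintro ⟨i, j, rfl, rfl, h⟩
      exact ⟨i.2, j.2, fun h' => h.ne (Fin.ext h'), fun hij => (hadj hij).1 h,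
        fun hij => (hadj hij).1 h.symm⟩
    · rintro ⟨hu, hv, hne, h1, h2⟩
      refine ⟨⟨u, hu⟩, ⟨v, hv⟩, rfl, rfl, ?_⟩
      rcases hne.lt_or_gt with h | h
      · exact (hadj (i := ⟨u, hu⟩) (j := ⟨v, hv⟩) h).2 (h1 h)
      · exact ((hadj (i := ⟨v, hv⟩) (j := ⟨u, hu⟩) h).2 (h2 h)).symm

open Classical in
/-- The number of color classes is at most the size of a clique. -/
theorem count_isFirst_le_chromaticNumber {M N : ℕ} {G : SimpleGraph (Fin N)} {r : ℕ → ℕ}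
    (h : IsLastNeighbor N (natAdj G) r) (hN : N ≤ M) :
    (Nat.count (IsFirst M N r) N : ℕ∞) ≤ G.chromaticNumber := by
  obtain ⟨c, hc⟩ : ∃ c, Nat.count (IsFirst M N r) N = c := ⟨_, rfl⟩
  rw [hc]
  cases c with
  | zero => simp
  | succ c =>
    have hlt : c < Nat.count (IsFirst M N r) N := by omega
    have hcard (hfin : (Set.ofPred (IsFirst M N r)).Finite) : c < hfin.toFinset.card :=
      hlt.trans_le (Nat.count_le_card hfin N)
    have hfN := Nat.nth_lt_of_lt_count hlt
    have hf := Nat.nth_mem c hcard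
    have hcount := Nat.count_nth hcard
    -- `f` is the last first node below `N`, with exactly `c` others before it.
    generalize Nat.nth (IsFirst M N r) c = f at *
    have hle := count_isFirst_le h.le_self hN hf hfN
    -- The intervals that contain the left endpoint of `f`, including `f` itself.
    let s : Finset (Fin N) := Finset.univ.filter fun k => (k : ℕ) ≤ f ∧ f ≤ r k
    have hs : c + 1 ≤ s.card := by
      have himg : insert f ((Finset.range f).filter fun k => f ≤ r k) ⊆
          Finset.image (fun k : Fin N => (k : ℕ)) s := by
        intro k hk
        simp only [Finset.mem_insert, Finset.mem_filter, Finset.mem_range] at hk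
        simp only [Finset.mem_image, s, Finset.mem_filter, Finset.mem_univ, true_and]
        rcases hk with rfl | hk
        · exact ⟨⟨k, hfN⟩, ⟨le_rfl, h.le_self k⟩, rfl⟩
        · exact ⟨⟨k, hk.1.trans hfN⟩, ⟨hk.1.le, hk.2⟩, rfl⟩
      have h1 := (Finset.card_le_card himg).trans Finset.card_image_le
      rw [Finset.card_insert_of_notMem (by simp)] at h1
      omega
    have hclique : G.IsClique (s : Set (Fin N)) := by
      intro i hi j hj hij
      simp only [s, Finset.coe_filter, Finset.mem_univ, true_and, Set.mem_ofPred_eq] at hi hj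
      obtain ⟨i', j', hi', hj', hadj⟩ := (h.adj_iff i j).2
        ⟨i.2, j.2, fun h => hij (Fin.ext h), fun _ => hj.1.trans hi.2, fun _ => hi.1.trans hj.2⟩
      rwa [Fin.ext hi', Fin.ext hj']
    exact le_trans (by exact_mod_cast hs) hclique.card_le_chromaticNumber

theorem exists_coloring {N : ℕ} {a b : Fin N → ℝ} (hab : ∀ i, a i < b i) (ha : Monotone a) :
    ∃ (k : ℕ) (C : (intervalGraph a b).Coloring (Fin k)),
      (k : ℕ∞) = (intervalGraph a b).chromaticNumber ∧
      ∀ (x l : Fin (Nat.clog 2 N) → Bool) (i : Fin N), bval x = i →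
        (output (intervalGraph a b) x l = true ↔ bval l = C i) := by
  classical
  obtain ⟨r, h⟩ := exists_isLastNeighbor hab ha
  have hN : N ≤ 2 ^ Nat.clog 2 N := Nat.le_pow_clog one_lt_two N
  set M := 2 ^ Nat.clog 2 N
  have hr := h.le_self
  have hlt (i : Fin N) : colorRank M N r hr i < Nat.count (IsFirst M N r) N := by
    obtain ⟨f, hf, hfi⟩ := exists_isFirst (M := M) (N := N) hr i
    rw [colorRank_eq_count hN hf hfi]
    exact Nat.count_strict_mono hf ((le_of_reflTransGen_isNext hr hfi).trans_lt i.2)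
  have hvalid {i j : Fin N} (hij : i < j) (hadj : (intervalGraph a b).Adj i j) :
      colorRank M N r hr i ≠ colorRank M N r hr j := by
    intro heq
    have h1 := lt_of_colorRank_eq hN hij heq
    exact h1.not_ge (((h.adj_iff i j).1 ⟨i, j, rfl, rfl, hadj⟩).2.2.2.1 hij)
  let C : (intervalGraph a b).Coloring (Fin (Nat.count (IsFirst M N r) N)) :=
    SimpleGraph.Coloring.mk (fun i => ⟨colorRank M N r hr i, hlt i⟩) fun {i j} hadj heq => by
      rw [Fin.mk.injEq] at heq
      rcases hadj.ne.lt_or_gt with hij | hij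
      · exact hvalid hij hadj heq
      · exact hvalid hij hadj.symm heq.symm
  refine ⟨_, C, le_antisymm (count_isFirst_le_chromaticNumber h hN) ?_, ?_⟩
  · simpa using C.colorable.chromaticNumber_le
  · intro x l i hi
    rw [output, coloringAlgorithm_spec h hN _ (fun σ => by simp [inputEnv])
      (fun σ => by simp [inputEnv, natAdj])]
    simp only [if_true, reduceCtorEq, if_false, hi]
    exact eq_comm

end ImplicitColoring

theorem mainTheorem7 :
    (∀ (N : ℕ) (a b : Fin N → ℝ), (∀ i, a i < b i) → Monotone a →
      ∃ (k : ℕ) (C : (ImplicitColoring.intervalGraph a b).Coloring (Fin k)),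
        (k : ℕ∞) = (ImplicitColoring.intervalGraph a b).chromaticNumber ∧
        ∀ (x l : Fin (Nat.clog 2 N) → Bool) (i : Fin N), ImplicitColoring.bval x = i →
          (ImplicitColoring.output (ImplicitColoring.intervalGraph a b) x l = true ↔
            ImplicitColoring.bval l = C i)) ∧
    (fun N : ℕ => ((ImplicitColoring.coloringAlgorithm (Nat.clog 2 N)).cost : ℝ))
      =O[Filter.atTop] (fun N : ℕ => Real.log N ^ 2) :=
  ⟨fun _ _ _ hab ha => ImplicitColoring.exists_coloring hab ha, ImplicitColoring.cost_isBigO⟩
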